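/- Let $\mathbf H^2_{\mathbb C}\subset\mathbb{CP}^2$ be the complex hyperbolic plane, i.e. the set of negative lines of a Hermitian form of signature $(2,1)$ on $\mathbb C^3$, let $S^3=\partial\mathbf H^2_{\mathbb C}$ be its sphere at infinity (the null lines), and let $\mathbf H^2_{\mathbb R}\subset\mathbf H^2_{\mathbb C}$ be the set of real points, with isometry group $\mathrm{PO}(2,1)\subset\mathrm{PU}(2,1)$. For $a\ne b$ in $S^3$, the arc from $a$ to $b$ is the open arc from $a$ to $b$ of the boundary of the complex line through $a$ and $b$, for the orientation given by the complex structure. The axis at infinity $\alpha_\delta$ of a loxodromic $\delta\in\mathrm{PU}(2,1)$ is the arc from its repulsive fixed point to its attractive fixed point. For a subgroup $\Delta\subset\mathrm{PU}(2,1)$ with limit set $\Lambda_\Delta\subset S^3$ and a loxodromic $\delta\in\Delta$, put $$\mathrm{Crown}_{\Delta,\delta}=\Lambda_\Delta\cup\bigcup_{g\in\Delta}g\cdot\alpha_\delta,\qquad \Omega_{\Delta,\delta}=S^3\setminus\mathrm{Crown}_{\Delta,\delta}.$$ Let $\Gamma\subset\mathrm{PO}(2,1)$ be a discrete subgroup such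 that $\Sigma=\Gamma\backslash\mathbf H^2_{\mathbb R}$ is compact, and let $U\Sigma=\Gamma\backslash U\mathbf H^2_{\mathbb R}$ be its unit tangent bundle. 1. For every $\gamma\in\Gamma$ that is loxodromic in $\mathrm{PU}(2,1)$, any two distinct translates $g\cdot\alpha_\gamma$, $h\cdot\alpha_\gamma$ ($g,h\in\Gamma$) are disjoint (the crown is embedded), and $\Gamma\backslash\Omega_{\Gamma,\gamma}$ is homeomorphic to the complement in $U\Sigma$ of the closed orbit of the geodesic flow that is the image of the oriented axis of $\gamma$. 2. Suppose that $\Gamma$ acts freely on $\mathbf H^2_{\mathbb R}$, so that $\Sigma$ is a closed hyperbolic surface with fundamental group $\Gamma$. Let $\lambda$ be a closed oriented geodesic of $\Sigma$, let $\hat\lambda\subset U\Sigma$ be its natural lift (a closed orbit of the geodesic flow), and let $U\Sigma(\lambda)=U\Sigma\setminus\hat\lambda$ be the drilled unit tangent bundle. Then there is a loxodromic $\gamma\in\Gamma$ whose oriented axis projects onto $\hat\lambda$, and $U\Sigma(\lambda)$ has a CR-spherical uniformization with $\mathbb R$-Fuchsian holonomy modelled on $\Omega_{\Gamma,\gamma}$.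 That is, for every base point $m$ there are a representation $\rho:\pi_1(U\Sigma(\lambda),m)\to\mathrm{PU}(2,1)$ with image $\Gamma$, acting properly discontinuously on the open set $\Omega_{\Gamma,\gamma}$, and a homeomorphism $\rho(\pi_1(U\Sigma(\lambda),m))\backslash\Omega_{\Gamma,\gamma}\cong U\Sigma(\lambda)$ whose holonomy is $\rho$: for some point $\tilde m\in\Omega_{\Gamma,\gamma}$ over $m$, every loop $c$ at $m$ lifts to a path in $\Omega_{\Gamma,\gamma}$ from $\rho([c])\tilde m$ to $\tilde m$, where products in $\pi_1$ are written so that $pq$ is the loop $q$ followed by the loop $p$. -/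

import Mathlib

open scoped MatrixGroups LinearAlgebra.Projectivization

namespace CRSpherical

noncomputable section

/-! ### The complex projective plane, `PU(2,1)` and the CR sphere -/

/-- The Hermitian form of signature `(2,1)` on `ℂ³` (linear in the first variable). -/
def herm (v w : Fin 3 → ℂ) : ℂ :=
  v 0 * star (w 0) + v 1 * star (w 1) - v 2 * star (w 2)

/-- The group `U(2,1)` of linear automorphisms of `ℂ³` preserving `herm`. -/
def U21 : Subgroup (GL (Fin 3) ℂ) where
  carrier := {A | ∀ v w, herm (A • v) (A • w) = herm v w}
  one_mem' := by intro v w; simp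
  mul_mem' := by
    intro A B hA hB v w
    rw [mul_smul, mul_smul, hA, hB]
  inv_mem' := by
    intro A hA v w
    rw [← hA (A⁻¹ • v) (A⁻¹ • w), smul_inv_smul, smul_inv_smul]

/-- `PU(2,1)`, the image of `U(2,1)` in `PGL(3, ℂ)`. -/
def PU21 : Subgroup PGL(3, ℂ) := U21.map Matrix.ProjGenLinGroup.mk

/-- The complex projective plane. -/
abbrev CP2 : Type := ℙ ℂ (Fin 3 → ℂ)

/-- `CP2` carries the quotient topology of `ℂ³ ∖ {0}`. -/
instance : TopologicalSpace CP2 :=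
  TopologicalSpace.coinduced
    (fun v : {v : Fin 3 → ℂ // v ≠ 0} => Projectivization.mk ℂ v.1 v.2) inferInstance

theorem scalar_smul_CP2 (u : ℂˣ) (p : CP2) :
    Matrix.GeneralLinearGroup.scalar (Fin 3) u • p = p := by
  induction p using Projectivization.ind with
  | h v hv =>
    rw [Projectivization.smul_mk, Projectivization.mk_eq_mk_iff]
    refine ⟨u, ?_⟩
    ext i
    simp [Units.smul_def, Matrix.smul_eq_mulVec, Matrix.mulVec_diagonal]

/-- The action of `PGL(3, ℂ)` on `CP2` by projective transformations. -/
instance : MulAction PGL(3, ℂ) CP2 :=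
  Matrix.ProjGenLinGroup.mulActionOfGL scalar_smul_CP2

/-- `v` is a lift to `ℂ³ ∖ {0}` of the point `p` of the projective plane. -/
def IsLift (v : Fin 3 → ℂ) (p : CP2) : Prop := ∃ h : v ≠ 0, Projectivization.mk ℂ v h = p

/-- The complex hyperbolic plane, as the set of points of negative type. -/
def H2C : Set CP2 := {p | ∃ v, IsLift v p ∧ (herm v v).re < 0}

/-- The sphere at infinity `S³ = ∂H²_ℂ`: the points of null type, with the topology of `CP2`. -/
abbrev S3 : Type := {p : CP2 // ∃ v, IsLift v p ∧ herm v v = 0}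

theorem smul_mem_S3 (g : PU21) (p : S3) :
    ∃ v, IsLift v ((g : PGL(3, ℂ)) • (p : CP2)) ∧ herm v v = 0 := by
  obtain ⟨g, A, hA, rfl⟩ := g
  obtain ⟨p, v, ⟨hv, rfl⟩, h⟩ := p
  exact ⟨A • v, ⟨(smul_ne_zero_iff_ne A).mpr hv, rfl⟩, by rw [hA v v, h]⟩

/-- The action of `PU(2,1)` on the sphere at infinity. -/
instance : MulAction PU21 S3 where
  smul g p := ⟨(g : PGL(3, ℂ)) • (p : CP2), smul_mem_S3 g p⟩
  one_smul p := Subtype.ext (one_smul _ (p : CP2))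
  mul_smul g h p := Subtype.ext (mul_smul (g : PGL(3, ℂ)) (h : PGL(3, ℂ)) (p : CP2))

/-! ### Arcs of `ℂ`-circles, limit sets and crowns -/

/-- The arc from `a` to `b` of the `ℂ`-circle through the points `a ≠ b`.
For lifts `A`, `B` with `⟨A, B⟩ = -1`, the points of the complex line through `a` and `b` other
than `a` are the `[s A + B]` with `s ∈ ℂ`; such a point lies in `H²_ℂ` iff `Re s > 0`, and is on
the sphere iff `Re s = 0`. For the boundary orientation of the half plane `Re s > 0` in the
complex coordinate `s`, the imaginary axis is run downwards, from `s = ∞` (the point `a`) through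
the `s = i y`, `y > 0`, to `s = 0` (the point `b`). -/
def arc (a b : S3) : Set S3 :=
  {p | ∃ A B : Fin 3 → ℂ, IsLift A a ∧ IsLift B b ∧ herm A B = -1 ∧
    ∃ y : ℝ, 0 < y ∧ IsLift ((Complex.I * (y : ℂ)) • A + B) p}

/-- `p` is an attractive fixed point of `γ`: a lift of `γ` to `U(2,1)` has an eigenvalue of
modulus `> 1` on the line `p`. -/
def IsAttractive (γ : PU21) (p : S3) : Prop :=
  ∃ A ∈ U21, Matrix.ProjGenLinGroup.mk A = (γ : PGL(3, ℂ)) ∧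
    ∃ v, IsLift v p ∧ ∃ μ : ℂ, 1 < ‖μ‖ ∧ A • v = μ • v

/-- `p` is a repulsive fixed point of `γ`. -/
def IsRepulsive (γ : PU21) (p : S3) : Prop := IsAttractive γ⁻¹ p

/-- `γ` is loxodromic: it has a repulsive and an attractive fixed point on the sphere. -/
def IsLoxodromic (γ : PU21) : Prop := (∃ a, IsRepulsive γ a) ∧ ∃ b, IsAttractive γ b

/-- The axis at infinity of a loxodromic element: the arc of `ℂ`-circle from its repulsive fixed
point to its attractive fixed point. -/
def axisAtInfinity (γ : PU21) : Set S3 :=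
  {p | ∃ a b, IsRepulsive γ a ∧ IsAttractive γ b ∧ p ∈ arc a b}

/-- The limit set of a subgroup of `PU(2,1)`: the points of the sphere that are limits of an orbit
in `H²_ℂ`. -/
def limitSet (Δ : Subgroup PU21) : Set S3 :=
  {p | ∃ x ∈ H2C, (p : CP2) ∈ closure {y : CP2 | ∃ g ∈ Δ, y = (g : PGL(3, ℂ)) • x}}

/-- The translate of a subset of the sphere by an element of `PU(2,1)`. -/
def translate (g : PU21) (s : Set S3) : Set S3 := (fun p => g • p) '' s

/-- The crown of `Δ` associated to `δ ∈ Δ`: the limit set together with all the translates of the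
axis at infinity of `δ`. -/
def crown (Δ : Subgroup PU21) (δ : PU21) : Set S3 :=
  limitSet Δ ∪ ⋃ g ∈ Δ, translate g (axisAtInfinity δ)

/-- The crown is embedded: any two distinct translates of the axis at infinity are disjoint. -/
def CrownEmbedded (Δ : Subgroup PU21) (δ : PU21) : Prop :=
  ∀ g ∈ Δ, ∀ h ∈ Δ,
    translate g (axisAtInfinity δ) ≠ translate h (axisAtInfinity δ) →
      Disjoint (translate g (axisAtInfinity δ)) (translate h (axisAtInfinity δ))

/-- The complement of the crown in the sphere. -/
def crownComplement (Δ : Subgroup PU21) (δ : PU21) : Set S3 := (crown Δ δ)ᶜ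

/-- The quotient `Δ \ Ω` of a subset `Ω` of the sphere: points are identified when they
lie in the same `Δ`-orbit. It carries the quotient topology. -/
abbrev QuotientOf (Δ : Subgroup PU21) (Ω : Set S3) : Type :=
  Quotient ((MulAction.orbitRel Δ S3).comap (Subtype.val : Ω → S3))

/-- The projection `Ω → Δ \ Ω`. -/
def toQuotientOf (Δ : Subgroup PU21) (Ω : Set S3) (x : Ω) : QuotientOf Δ Ω := Quotient.mk _ x

/-- A CR-spherical uniformization of a space `M` with base point `m`: a holonomy representation
`ρ : π₁(M, m) → PU(2,1)`, an open subset `Ω` of the sphere on which the image of `ρ` acts properly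
discontinuously, and a homeomorphism `ρ(π₁(M, m)) \ Ω ≃ M`, for which `ρ` is the holonomy:
each loop `c` at `m` lifts to a path in `Ω` from `ρ([c]) • base` to `base`.
(In `FundamentalGroup`, `p * q` is the class of the loop `q` followed by the loop `p`, so that this
is the convention for which the holonomy is a homomorphism.) -/
structure CRUniformization (M : Type) [TopologicalSpace M] (m : M) where
  ρ : FundamentalGroup M m →* PU21
  Ω : Set S3
  isOpen : IsOpen Ω
  smul_mem : ∀ g ∈ ρ.range, ∀ x ∈ Ω, g • x ∈ Ω
  properlyDiscontinuous : ∀ K ⊆ Ω, IsCompact K →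
    {g : PU21 | g ∈ ρ.range ∧ (translate g K ∩ K).Nonempty}.Finite
  homeo : QuotientOf ρ.range Ω ≃ₜ M
  base : Ω
  homeo_base : homeo (toQuotientOf ρ.range Ω base) = m
  holonomy : ∀ c : Path m m, ∃ (x : Ω) (α : Path x base),
    (∀ t, homeo (toQuotientOf ρ.range Ω (α t)) = c t) ∧
      (x : S3) = ρ (FundamentalGroup.fromPath (Path.Homotopic.Quotient.mk c)) • (base : S3)

/-! ### The real hyperbolic plane, `PO(2,1)` and unit tangent bundles -/

/-- The restriction of `herm` to `ℝ³`. -/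
def mink (x y : Fin 3 → ℝ) : ℝ := x 0 * y 0 + x 1 * y 1 - x 2 * y 2

theorem mink_neg (x : Fin 3 → ℝ) : mink (-x) (-x) = mink x x := by simp [mink]

/-- The real hyperbolic plane, as the upper sheet of the hyperboloid (each point of
`H²_ℂ` with a real lift has exactly one lift there). -/
abbrev HR2 : Type := {x : Fin 3 → ℝ // mink x x = -1 ∧ 0 < x 2}

/-- `PO(2,1)`, the isometry group of the real hyperbolic plane (orientation reversing isometries
included): each class of `O(2,1) / {±1}` has exactly one representative that preserves the upper
sheet of the hyperboloid, and this is the group of these representatives. -/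
def PO21 : Subgroup (GL (Fin 3) ℝ) where
  carrier := {A | (∀ x y, mink (A • x) (A • y) = mink x y) ∧
    ∀ x, mink x x = -1 → 0 < x 2 → 0 < (A • x) 2}
  one_mem' := by constructor <;> simp
  mul_mem' := by
    rintro A B ⟨hA, hA'⟩ ⟨hB, hB'⟩
    refine ⟨fun x y => by rw [mul_smul, mul_smul, hA, hB], fun x hx hx' => ?_⟩
    rw [mul_smul]
    exact hA' _ (by rw [hB, hx]) (hB' x hx hx')
  inv_mem' := by
    rintro A ⟨hA, hA'⟩
    have key : ∀ x y, mink (A⁻¹ • x) (A⁻¹ • y) = mink x y := fun x y => by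
      rw [← hA (A⁻¹ • x) (A⁻¹ • y), smul_inv_smul, smul_inv_smul]
    refine ⟨key, fun x hx hx' => ?_⟩
    by_contra hneg
    have h1 : mink (A⁻¹ • x) (A⁻¹ • x) = -1 := by rw [key, hx]
    have h2 : (A⁻¹ • x) 2 ≠ 0 := by
      intro h0
      rw [mink, h0] at h1
      nlinarith [mul_self_nonneg ((A⁻¹ • x) 0), mul_self_nonneg ((A⁻¹ • x) 1)]
    have h3 : (A⁻¹ • x) 2 < 0 := lt_of_le_of_ne (not_lt.mp hneg) h2
    have h4 := hA' (-(A⁻¹ • x)) (by rw [mink_neg, h1]) (by simpa using h3)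
    rw [smul_neg, smul_inv_smul] at h4
    have h5 : (-x) 2 = -(x 2) := rfl
    linarith

theorem map_mem_U21 (A : PO21) :
    Matrix.GeneralLinearGroup.map Complex.ofRealHom (A : GL (Fin 3) ℝ) ∈ U21 := by
  have key : ∀ v : Fin 3 → ℂ, ∀ i,
      (Matrix.GeneralLinearGroup.map Complex.ofRealHom (A : GL (Fin 3) ℝ) • v) i =
        ((((A : GL (Fin 3) ℝ) • fun j => (v j).re) i : ℝ) : ℂ) +
          ((((A : GL (Fin 3) ℝ) • fun j => (v j).im) i : ℝ) : ℂ) * Complex.I := by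
    intro v i
    apply Complex.ext <;>
      simp [Units.smul_def, Matrix.smul_eq_mulVec, Matrix.mulVec, dotProduct]
  have herm_eq : ∀ a b c d : Fin 3 → ℝ,
      herm (fun i => (a i : ℂ) + (b i : ℂ) * Complex.I)
          (fun i => (c i : ℂ) + (d i : ℂ) * Complex.I) =
        ((mink a c + mink b d : ℝ) : ℂ) + ((mink b c - mink a d : ℝ) : ℂ) * Complex.I := by
    intro a b c d
    apply Complex.ext <;> simp [herm, mink] <;> ring
  intro v w
  rw [funext (key v), funext (key w), herm_eq, A.2.1, A.2.1, A.2.1, A.2.1, ← herm_eq]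
  congr 1 <;> ext i <;> simp

/-- The inclusion `PO(2,1) ⊂ PU(2,1)`. -/
def toPU : PO21 →* PU21 where
  toFun A := ⟨Matrix.ProjGenLinGroup.mk
    (Matrix.GeneralLinearGroup.map Complex.ofRealHom (A : GL (Fin 3) ℝ)), _, map_mem_U21 A, rfl⟩
  map_one' := by apply Subtype.ext; simp
  map_mul' A B := by apply Subtype.ext; simp

/-- The action of `PO(2,1)` on the real hyperbolic plane. -/
instance : MulAction PO21 HR2 where
  smul A x := ⟨(A : GL (Fin 3) ℝ) • x.1, by rw [A.2.1, x.2.1], A.2.2 _ x.2.1 x.2.2⟩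
  one_smul x := Subtype.ext (one_smul _ x.1)
  mul_smul A B x := Subtype.ext (mul_smul (A : GL (Fin 3) ℝ) (B : GL (Fin 3) ℝ) x.1)

/-- The unit tangent bundle of the real hyperbolic plane: pairs `(x, u)` of a point `x` of the
upper sheet of the hyperboloid and a unit vector `u` tangent to it at `x`. -/
abbrev UHR2 : Type :=
  {w : (Fin 3 → ℝ) × (Fin 3 → ℝ) //
    (mink w.1 w.1 = -1 ∧ 0 < w.1 2) ∧ mink w.1 w.2 = 0 ∧ mink w.2 w.2 = 1}

/-- The action of `PO(2,1)` on the unit tangent bundle (isometries act by their differential). -/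
instance : MulAction PO21 UHR2 where
  smul A w := ⟨((A : GL (Fin 3) ℝ) • w.1.1, (A : GL (Fin 3) ℝ) • w.1.2),
    ⟨by rw [A.2.1, w.2.1.1], A.2.2 _ w.2.1.1 w.2.1.2⟩,
    by rw [A.2.1, w.2.2.1], by rw [A.2.1, w.2.2.2]⟩
  one_smul w := Subtype.ext (Prod.ext (one_smul _ w.1.1) (one_smul _ w.1.2))
  mul_smul A B w := Subtype.ext (Prod.ext
    (mul_smul (A : GL (Fin 3) ℝ) (B : GL (Fin 3) ℝ) w.1.1)
    (mul_smul (A : GL (Fin 3) ℝ) (B : GL (Fin 3) ℝ) w.1.2))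

theorem flow_aux (t : ℝ) (w : UHR2) :
    (mink (Real.cosh t • w.1.1 + Real.sinh t • w.1.2)
          (Real.cosh t • w.1.1 + Real.sinh t • w.1.2) = -1 ∧
        0 < (Real.cosh t • w.1.1 + Real.sinh t • w.1.2) 2) ∧
      mink (Real.cosh t • w.1.1 + Real.sinh t • w.1.2)
          (Real.sinh t • w.1.1 + Real.cosh t • w.1.2) = 0 ∧
      mink (Real.sinh t • w.1.1 + Real.cosh t • w.1.2)
          (Real.sinh t • w.1.1 + Real.cosh t • w.1.2) = 1 := by
  obtain ⟨⟨x, u⟩, ⟨h1, h2⟩, h3, h4⟩ := w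
  change mink x x = -1 at h1
  change 0 < x 2 at h2
  change mink x u = 0 at h3
  change mink u u = 1 at h4
  simp only [mink] at h1 h3 h4
  simp only [mink, Pi.add_apply, Pi.smul_apply, smul_eq_mul]
  have hc := Real.cosh_sq t
  have hpos := Real.cosh_pos t
  refine ⟨⟨?_, ?_⟩, ?_, ?_⟩
  · linear_combination Real.cosh t ^ 2 * h1 + 2 * Real.cosh t * Real.sinh t * h3 +
      Real.sinh t ^ 2 * h4 - hc
  · have h5 : u 2 ^ 2 < x 2 ^ 2 := by
      have h9 : (x 0 * u 1 - x 1 * u 0) ^ 2 = x 2 ^ 2 - 1 - u 2 ^ 2 := by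
        linear_combination (u 0 * u 0 + u 1 * u 1) * h1 + (x 2 ^ 2 - 1) * h4 -
          (x 0 * u 0 + x 1 * u 1 + x 2 * u 2) * h3
      nlinarith [sq_nonneg (x 0 * u 1 - x 1 * u 0)]
    have h6 : |u 2| < x 2 := abs_lt_of_sq_lt_sq h5 h2.le
    have h7 : |Real.sinh t| < Real.cosh t := abs_lt_of_sq_lt_sq (by linarith) hpos.le
    have h8 : |Real.sinh t * u 2| < Real.cosh t * x 2 := by
      rw [abs_mul]
      exact mul_lt_mul'' h7 h6 (abs_nonneg _) (abs_nonneg _)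
    linarith [(abs_lt.mp h8).1]
  · linear_combination Real.cosh t * Real.sinh t * h1 +
      (Real.cosh t ^ 2 + Real.sinh t ^ 2) * h3 + Real.cosh t * Real.sinh t * h4
  · linear_combination Real.sinh t ^ 2 * h1 + 2 * Real.cosh t * Real.sinh t * h3 +
      Real.cosh t ^ 2 * h4 + hc

/-- The geodesic flow on the unit tangent bundle of the real hyperbolic plane (for the metric of
curvature `-1`). -/
def geodesicFlow (t : ℝ) (w : UHR2) : UHR2 :=
  ⟨(Real.cosh t • w.1.1 + Real.sinh t • w.1.2, Real.sinh t • w.1.1 + Real.cosh t • w.1.2),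
    flow_aux t w⟩

/-- The surface `Σ = Γ \ H²_ℝ`. -/
abbrev Surface (Γ : Subgroup PO21) : Type := MulAction.orbitRel.Quotient Γ HR2

/-- The unit tangent bundle `UΣ = Γ \ U H²_ℝ` of the surface `Σ = Γ \ H²_ℝ`. -/
abbrev UnitTangent (Γ : Subgroup PO21) : Type := MulAction.orbitRel.Quotient Γ UHR2

/-- The projection `U H²_ℝ → UΣ`. -/
def toUnitTangent (Γ : Subgroup PO21) (w : UHR2) : UnitTangent Γ := Quotient.mk _ w

/-- The natural lifts to `UΣ` of the closed oriented geodesics of `Σ`, that is, the closed orbits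
of the geodesic flow of `Σ`. -/
def IsClosedGeodesicLift (Γ : Subgroup PO21) (l : Set (UnitTangent Γ)) : Prop :=
  ∃ w : UHR2,
    (∃ T : ℝ, 0 < T ∧ toUnitTangent Γ (geodesicFlow T w) = toUnitTangent Γ w) ∧
      l = Set.range fun t : ℝ => toUnitTangent Γ (geodesicFlow t w)

/-- The axis of `γ ∈ PO(2,1)` lifted to the unit tangent bundle: the unit vectors that `γ`
translates forwards along the geodesic that they generate. -/
def liftedAxis (γ : PO21) : Set UHR2 := {w | ∃ l : ℝ, 0 < l ∧ γ • w = geodesicFlow l w}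

/-- The closed orbit of the geodesic flow of `Σ` that corresponds to a loxodromic `γ ∈ Γ`. -/
def closedOrbit (Γ : Subgroup PO21) (γ : PO21) : Set (UnitTangent Γ) :=
  toUnitTangent Γ '' liftedAxis γ

/-- The unit tangent bundle `UΣ` drilled out along a subset `l`: the complement of `l` in `UΣ`. -/
abbrev Drilled (Γ : Subgroup PO21) (l : Set (UnitTangent Γ)) : Type := {w : UnitTangent Γ // w ∉ l}

end

end CRSpherical

open CRSpherical

/-! Send a unit tangent vector `(x, u)` of the real hyperbolic plane to the point `[x - i u]` of the
sphere. The map `toSphere` is equivariant under `PO21` because real matrices commute with the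
complex structure, and everything is read through it.

The complex bilinear extension `cdot` of `mink` is also preserved by `PO21`. A null vector `v` with
`cdot v v ≠ 0` can be rescaled, uniquely up to sign, to have `cdot v v = -2`; its real part and
minus its imaginary part then form a unit tangent vector, up to sign. If `cdot v v = 0`, then `v` is
proportional to a real null vector. Hence `toSphere` is an open embedding onto the complement of the
circle of real points (`isOpenEmbedding_toSphere`).

Two facts identify the crown. For cocompact `Γ` the limit set is exactly that circle
(`limitSet_eq`). The axis at infinity of `γ` is the image of the flow line of unit vectors that `γ`
translates (`axisAtInfinity_eq`): the geodesic through `(x, u)` ends at the null vectors `x - u` and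
`x + u`, and `[x - i u]` lies on the arc between them. So translates of the axis are flow lines,
which coincide or are disjoint, and the complement of the crown is the preimage of the complement of
the closed orbit (`crownComplement_eq`). The first claim follows on dividing by `Γ`.

For the second claim, a discrete `Γ` acts properly on the unit tangent bundle, since `PO21` acts
transitively with finite stabilizers. If it acts freely on the plane, the complement of the crown is
a covering of the drilled bundle with group `Γ`, whose monodromy gives the holonomy. The image is
all of `Γ` because the covering space is path connected (`isPathConnected_drilledPreimage`): only
countably many geodesics are removed, and the space of oriented geodesics is a surface. -/

namespace CRSpherical

noncomputable section

open Topology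

/-! ### Linear algebra of the real points -/

/-- The inclusion `ℝ³ ⊂ ℂ³`. -/
def ofR (x : Fin 3 → ℝ) : Fin 3 → ℂ := fun i => (x i : ℂ)

/-- The complex bilinear form that extends `mink`. -/
def cdot (v w : Fin 3 → ℂ) : ℂ := v 0 * w 0 + v 1 * w 1 - v 2 * w 2

/-- The complex linear extension of an element of `GL(3, ℝ)`. -/
abbrev complexify (A : GL (Fin 3) ℝ) : GL (Fin 3) ℂ :=
  Matrix.GeneralLinearGroup.map Complex.ofRealHom A

theorem GL_smul_smul {K : Type*} [Field K] (A : GL (Fin 3) K) (c : K) (v : Fin 3 → K) :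
    A • (c • v) = c • (A • v) := by
  simp only [Units.smul_def, Matrix.smul_eq_mulVec, Matrix.mulVec_smul]

theorem complexify_smul_ofR (A : GL (Fin 3) ℝ) (x : Fin 3 → ℝ) :
    complexify A • ofR x = ofR (A • x) := by
  ext i
  simp [ofR, Units.smul_def, Matrix.smul_eq_mulVec, Matrix.mulVec, dotProduct]

theorem exists_re_im (v : Fin 3 → ℂ) :
    ∃ a b : Fin 3 → ℝ, v = ofR a + Complex.I • ofR b :=
  ⟨fun i => (v i).re, fun i => (v i).im, by
    ext i
    simp only [ofR, Pi.add_apply, Pi.smul_apply, smul_eq_mul]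
    rw [mul_comm, Complex.re_add_im]⟩

theorem cdot_ofR (a b c d : Fin 3 → ℝ) :
    cdot (ofR a + Complex.I • ofR b) (ofR c + Complex.I • ofR d) =
      ((mink a c - mink b d : ℝ) : ℂ) + Complex.I * ((mink a d + mink b c : ℝ) : ℂ) := by
  simp only [cdot, ofR, mink, Pi.add_apply, Pi.smul_apply, smul_eq_mul]
  push_cast
  linear_combination ((b 0 : ℂ) * d 0 + b 1 * d 1 - b 2 * d 2) * Complex.I_sq

/-- A real matrix acts separately on real and imaginary parts, so invariance of `mink` extends
bilinearly. Together with `herm` this gives two invariants of complex vectors under `PO21`. -/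
theorem cdot_complexify (A : PO21) (v w : Fin 3 → ℂ) :
    cdot (complexify A • v) (complexify A • w) = cdot v w := by
  obtain ⟨a, b, rfl⟩ := exists_re_im v
  obtain ⟨c, d, rfl⟩ := exists_re_im w
  simp only [smul_add, GL_smul_smul, complexify_smul_ofR, cdot_ofR, A.2.1]

theorem continuous_cdot_self : Continuous fun v => cdot v v := by
  unfold cdot
  fun_prop

theorem cdot_smul (c : ℂ) (v : Fin 3 → ℂ) : cdot (c • v) (c • v) = c ^ 2 * cdot v v := by
  simp only [cdot, Pi.smul_apply, smul_eq_mul]; ring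

theorem herm_smul_smul (c d : ℂ) (v w : Fin 3 → ℂ) :
    herm (c • v) (d • w) = c * star d * herm v w := by
  simp only [herm, Pi.smul_apply, smul_eq_mul, star_mul']; ring

theorem herm_smul (c : ℂ) (v : Fin 3 → ℂ) :
    herm (c • v) (c • v) = ((‖c‖ ^ 2 : ℝ) : ℂ) * herm v v := by
  rw [herm_smul_smul]
  congr 1
  rw [Complex.star_def, Complex.mul_conj, Complex.normSq_eq_norm_sq]

theorem herm_ofR (a b : Fin 3 → ℝ) : herm (ofR a) (ofR b) = (mink a b : ℝ) := by
  simp [herm, ofR, mink]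

theorem ofR_ne_zero {a : Fin 3 → ℝ} (h : 0 < a 2) : ofR a ≠ 0 := by
  intro h0
  have := congrFun h0 2
  simp only [ofR, Pi.zero_apply, Complex.ofReal_eq_zero] at this
  exact h.ne' this

theorem mink_comm (a b : Fin 3 → ℝ) : mink a b = mink b a := by simp only [mink]; ring

theorem mink_add_left (a b c : Fin 3 → ℝ) : mink (a + b) c = mink a c + mink b c := by
  simp only [mink, Pi.add_apply]; ring

theorem mink_add_right (a b c : Fin 3 → ℝ) : mink c (a + b) = mink c a + mink c b := by
  simp only [mink, Pi.add_apply]; ring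

theorem mink_sub_left (a b c : Fin 3 → ℝ) : mink (a - b) c = mink a c - mink b c := by
  simp only [mink, Pi.sub_apply]; ring

theorem mink_sub_right (a b c : Fin 3 → ℝ) : mink c (a - b) = mink c a - mink c b := by
  simp only [mink, Pi.sub_apply]; ring

theorem mink_smul_left (s : ℝ) (a b : Fin 3 → ℝ) : mink (s • a) b = s * mink a b := by
  simp only [mink, Pi.smul_apply, smul_eq_mul]; ring

theorem mink_smul_right (s : ℝ) (a b : Fin 3 → ℝ) : mink a (s • b) = s * mink a b := by
  simp only [mink, Pi.smul_apply, smul_eq_mul]; ring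

theorem abs_snd_lt (w : UHR2) : |w.1.2 2| < w.1.1 2 := by
  obtain ⟨⟨x, u⟩, ⟨h1, h2⟩, h3, h4⟩ := w
  change mink x x = -1 at h1
  change 0 < x 2 at h2
  change mink x u = 0 at h3
  change mink u u = 1 at h4
  simp only [mink] at h1 h3 h4
  have h9 : (x 0 * u 1 - x 1 * u 0) ^ 2 = x 2 ^ 2 - 1 - u 2 ^ 2 := by
    linear_combination (u 0 * u 0 + u 1 * u 1) * h1 + (x 2 ^ 2 - 1) * h4 -
      (x 0 * u 0 + x 1 * u 1 + x 2 * u 2) * h3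
  exact abs_lt_of_sq_lt_sq (by nlinarith [sq_nonneg (x 0 * u 1 - x 1 * u 0)]) h2.le

/-! ### The topology of the projective plane -/

theorem isLift_mk (v : Fin 3 → ℂ) (h : v ≠ 0) : IsLift v (Projectivization.mk ℂ v h) := ⟨h, rfl⟩

theorem exists_isLift (p : CP2) : ∃ v, IsLift v p :=
  ⟨p.rep, p.rep_nonzero, p.mk_rep⟩

theorem IsLift.eq_smul {v w : Fin 3 → ℂ} {p : CP2} (hv : IsLift v p) (hw : IsLift w p) :
    ∃ c : ℂ, c ≠ 0 ∧ v = c • w := by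
  obtain ⟨h, rfl⟩ := hv
  obtain ⟨h', e⟩ := hw
  obtain ⟨c, hc⟩ := (Projectivization.mk_eq_mk_iff' ℂ v w h h').1 e.symm
  refine ⟨c, ?_, hc.symm⟩
  rintro rfl
  exact h (by rw [← hc, zero_smul])

theorem IsLift.smul {v : Fin 3 → ℂ} {p : CP2} (hv : IsLift v p) {c : ℂ} (hc : c ≠ 0) :
    IsLift (c • v) p := by
  obtain ⟨h, rfl⟩ := hv
  exact ⟨smul_ne_zero hc h, (Projectivization.mk_eq_mk_iff' ℂ _ _ _ _).2 ⟨c, rfl⟩⟩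

theorem IsLift.unique {v : Fin 3 → ℂ} {p q : CP2} (hp : IsLift v p) (hq : IsLift v q) :
    p = q := by
  obtain ⟨h, rfl⟩ := hp
  obtain ⟨h', rfl⟩ := hq
  rfl

theorem isLift_toPU_smul (A : PO21) {v : Fin 3 → ℂ} {p : CP2} (hv : IsLift v p) :
    IsLift (complexify A • v) ((toPU A : PGL(3, ℂ)) • p) := by
  obtain ⟨h, rfl⟩ := hv
  exact ⟨(smul_ne_zero_iff_ne _).mpr h, rfl⟩

theorem isOpenQuotientMap_mk :
    IsOpenQuotientMap
      (fun v : {v : Fin 3 → ℂ // v ≠ 0} => (Projectivization.mk ℂ v.1 v.2 : CP2)) := by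
  have hq : IsQuotientMap
      (fun v : {v : Fin 3 → ℂ // v ≠ 0} => (Projectivization.mk ℂ v.1 v.2 : CP2)) :=
    ⟨⟨rfl⟩, fun p => ⟨⟨p.rep, p.rep_nonzero⟩, p.mk_rep⟩⟩
  refine ⟨hq.surjective, hq.continuous, fun U hU => ?_⟩
  rw [← hq.isOpen_preimage]
  -- The saturation of `U` is the union of its rescalings by nonzero scalars, hence open.
  have : (fun v : {v : Fin 3 → ℂ // v ≠ 0} => (Projectivization.mk ℂ v.1 v.2 : CP2)) ⁻¹'
      ((fun v : {v : Fin 3 → ℂ // v ≠ 0} => (Projectivization.mk ℂ v.1 v.2 : CP2)) '' U) =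
      ⋃ c : {c : ℂ // c ≠ 0}, (fun v : {v : Fin 3 → ℂ // v ≠ 0} =>
        (⟨c.1 • v.1, smul_ne_zero c.2 v.2⟩ : {v : Fin 3 → ℂ // v ≠ 0})) ⁻¹' U := by
    ext v
    simp only [Set.mem_preimage, Set.mem_image, Set.mem_iUnion]
    constructor
    · rintro ⟨w, hw, e⟩
      obtain ⟨c, hc, h⟩ := (show IsLift w.1 _ from ⟨w.2, e⟩).eq_smul (isLift_mk v.1 v.2)
      refine ⟨⟨c, hc⟩, ?_⟩
      convert hw using 1
      exact Subtype.ext h.symm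
    · rintro ⟨c, hc⟩
      exact ⟨_, hc, ((isLift_mk v.1 v.2).smul c.2).2⟩
  rw [this]
  refine isOpen_iUnion fun c => hU.preimage ?_
  exact Continuous.subtype_mk (continuous_subtype_val.const_smul c.1) _

theorem continuous_mk_comp {X : Type*} [TopologicalSpace X] {f : X → Fin 3 → ℂ}
    (hf : Continuous f) (h : ∀ x, f x ≠ 0) :
    Continuous fun x => (Projectivization.mk ℂ (f x) (h x) : CP2) :=
  isOpenQuotientMap_mk.continuous.comp (hf.subtype_mk h)

/-! ### The unit tangent bundle inside the sphere -/

theorem ofR_add_smul_ne_zero (w : UHR2) (c : ℂ) (hc : c.re = 0) :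
    ofR w.1.1 + c • ofR w.1.2 ≠ 0 := by
  intro h
  have h2 := congrArg Complex.re (congrFun h 2)
  simp [ofR, hc] at h2
  exact w.2.1.2.ne' h2

/-- The vector `x - i u ∈ ℂ³`. -/
def nullVec (w : UHR2) : Fin 3 → ℂ := ofR w.1.1 + (-Complex.I) • ofR w.1.2

theorem nullVec_ne_zero (w : UHR2) : nullVec w ≠ 0 := ofR_add_smul_ne_zero w _ (by simp)

theorem herm_nullVec (w : UHR2) : herm (nullVec w) (nullVec w) = 0 := by
  have h1 := w.2.1.1
  have h3 := w.2.2.1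
  have h4 := w.2.2.2
  simp only [mink] at h1 h3 h4
  simp only [herm, nullVec, ofR, Pi.add_apply, Pi.smul_apply, smul_eq_mul]
  apply Complex.ext
  · simp
    linear_combination h1 + h4
  · simp
    ring

/-- The value `-2` normalizes lifts: only the scalars `±1` preserve it, and the sign is then fixed
by the upper sheet. -/
theorem cdot_nullVec (w : UHR2) : cdot (nullVec w) (nullVec w) = -2 := by
  have h1 := w.2.1.1
  have h3 := w.2.2.1
  have h4 := w.2.2.2
  simp only [mink] at h1 h3 h4
  simp only [cdot, nullVec, ofR, Pi.add_apply, Pi.smul_apply, smul_eq_mul]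
  apply Complex.ext
  · simp
    linear_combination h1 - h4
  · simp
    linear_combination -2 * h3

/-- The point `[x - i u]` of the sphere, for a unit tangent vector `u` of `H²_ℝ` at `x`. -/
def toSphere (w : UHR2) : S3 :=
  ⟨Projectivization.mk ℂ (nullVec w) (nullVec_ne_zero w), nullVec w, isLift_mk _ _,
    herm_nullVec w⟩

theorem isLift_toSphere (w : UHR2) : IsLift (nullVec w) (toSphere w : CP2) := isLift_mk _ _

theorem continuous_nullVec : Continuous nullVec := by
  refine continuous_pi fun i => ?_
  simp only [nullVec, ofR, Pi.add_apply, Pi.smul_apply, smul_eq_mul]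
  fun_prop

theorem continuous_toSphere : Continuous toSphere :=
  (continuous_mk_comp continuous_nullVec nullVec_ne_zero).subtype_mk _

theorem nullVec_smul (A : PO21) (w : UHR2) : nullVec (A • w) = complexify A • nullVec w := by
  rw [nullVec, nullVec, smul_add, GL_smul_smul, complexify_smul_ofR, complexify_smul_ofR]
  rfl

theorem toSphere_smul (A : PO21) (w : UHR2) : toSphere (A • w) = toPU A • toSphere w := by
  apply Subtype.ext
  have h := isLift_toPU_smul A (isLift_toSphere w)
  rw [← nullVec_smul] at h
  exact (isLift_toSphere (A • w)).unique h

/-- The real part of the scale invariant matrix `(v v^* / |v.v| - v v^T / v.v)`. -/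
def reMat (v : Fin 3 → ℂ) (i j : Fin 3) : ℝ :=
  (v i * star (v j) / ‖cdot v v‖ - v i * v j / cdot v v).re

/-- The imaginary part of the scale invariant matrix `(v v^* / |v.v| + v v^T / v.v)`. -/
def imMat (v : Fin 3 → ℂ) (i j : Fin 3) : ℝ :=
  (v i * star (v j) / ‖cdot v v‖ + v i * v j / cdot v v).im

/-- Under scaling by `c`, `v i * star (v j)` and `‖cdot v v‖` both gain the factor `‖c‖ ^ 2`, while
`v i * v j` and `cdot v v` both gain `c ^ 2`. -/
theorem reMat_smul {c : ℂ} (hc : c ≠ 0) (v : Fin 3 → ℂ) : reMat (c • v) = reMat v := by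
  ext i j
  simp only [reMat, cdot_smul, Pi.smul_apply, smul_eq_mul, star_mul', norm_mul, norm_pow]
  congr 2
  · rw [mul_mul_mul_comm, Complex.star_def, Complex.mul_conj, Complex.normSq_eq_norm_sq]
    push_cast
    rw [mul_div_mul_left _ _ (by simpa using hc)]
  · rw [mul_mul_mul_comm, ← pow_two, mul_div_mul_left _ _ (pow_ne_zero 2 hc)]

theorem imMat_smul {c : ℂ} (hc : c ≠ 0) (v : Fin 3 → ℂ) : imMat (c • v) = imMat v := by
  ext i j
  simp only [imMat, cdot_smul, Pi.smul_apply, smul_eq_mul, star_mul', norm_mul, norm_pow]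
  congr 2
  · rw [mul_mul_mul_comm, Complex.star_def, Complex.mul_conj, Complex.normSq_eq_norm_sq]
    push_cast
    rw [mul_div_mul_left _ _ (by simpa using hc)]
  · rw [mul_mul_mul_comm, ← pow_two, mul_div_mul_left _ _ (pow_ne_zero 2 hc)]

/-- With `v = x - i u` and `v.v = -2`, the matrix before taking real parts is `v i * Re (v j) = (x i
- i u i) x j`. Row `2` of the result, divided by `x 2`, recovers `x`; `imMat` recovers `u` in the
same way. -/
theorem reMat_nullVec (w : UHR2) (i j : Fin 3) : reMat (nullVec w) i j = w.1.1 i * w.1.1 j := by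
  simp only [reMat, cdot_nullVec]
  simp [nullVec, ofR, Complex.div_re, Complex.normSq_apply]
  ring

theorem imMat_nullVec (w : UHR2) (i j : Fin 3) : imMat (nullVec w) i j = w.1.1 i * w.1.2 j := by
  simp only [imMat, cdot_nullVec]
  simp [nullVec, ofR, Complex.div_im, Complex.normSq_apply]
  ring

/-- The inverse of `toSphere`, on lifts. -/
def frameOfVec (v : Fin 3 → ℂ) : (Fin 3 → ℝ) × (Fin 3 → ℝ) :=
  (fun j => reMat v 2 j / √(reMat v 2 2), fun j => imMat v 2 j / √(reMat v 2 2))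

theorem frameOfVec_nullVec (w : UHR2) : frameOfVec (nullVec w) = w.1 := by
  have h := w.2.1.2
  have h2 : √(w.1.1 2 * w.1.1 2) = w.1.1 2 := Real.sqrt_mul_self h.le
  apply Prod.ext <;> ext j <;>
    simp only [frameOfVec, reMat_nullVec, imMat_nullVec, h2] <;> field_simp

theorem frameOfVec_smul {c : ℂ} (hc : c ≠ 0) (v : Fin 3 → ℂ) :
    frameOfVec (c • v) = frameOfVec v := by
  rw [frameOfVec, reMat_smul hc, imMat_smul hc, frameOfVec]

/-- The inverse of `toSphere`. -/
def frameOfPoint (p : CP2) : (Fin 3 → ℝ) × (Fin 3 → ℝ) := frameOfVec p.rep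

theorem frameOfPoint_eq {v : Fin 3 → ℂ} {p : CP2} (h : IsLift v p) :
    frameOfPoint p = frameOfVec v := by
  obtain ⟨c, hc, e⟩ := (show IsLift p.rep p from ⟨p.rep_nonzero, p.mk_rep⟩).eq_smul h
  rw [frameOfPoint, e, frameOfVec_smul hc]

theorem continuousAt_frameOfVec (w : UHR2) : ContinuousAt frameOfVec (nullVec w) := by
  have h := w.2.1.2
  have hQ : cdot (nullVec w) (nullVec w) ≠ 0 := by rw [cdot_nullVec]; norm_num
  have hc : ContinuousAt (fun v => cdot v v) (nullVec w) :=
    continuous_cdot_self.continuousAt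
  have hr : ∀ i j, ContinuousAt (fun v => reMat v i j) (nullVec w) := by
    intro i j
    unfold reMat
    refine Complex.continuous_re.continuousAt.comp (ContinuousAt.sub ?_ ?_)
    · refine ContinuousAt.div (by fun_prop) ?_ (by simpa using hQ)
      exact Complex.continuous_ofReal.continuousAt.comp hc.norm
    · exact ContinuousAt.div (by fun_prop) hc hQ
  have hi : ∀ i j, ContinuousAt (fun v => imMat v i j) (nullVec w) := by
    intro i j
    unfold imMat
    refine Complex.continuous_im.continuousAt.comp (ContinuousAt.add ?_ ?_)
    · refine ContinuousAt.div (by fun_prop) ?_ (by simpa using hQ)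
      exact Complex.continuous_ofReal.continuousAt.comp hc.norm
    · exact ContinuousAt.div (by fun_prop) hc hQ
  have hs : √(reMat (nullVec w) 2 2) ≠ 0 := by
    rw [reMat_nullVec, Real.sqrt_mul_self h.le]
    exact h.ne'
  have hs' : ContinuousAt (fun v => √(reMat v 2 2)) (nullVec w) :=
    Real.continuous_sqrt.continuousAt.comp (hr 2 2)
  exact ContinuousAt.prodMk
    (continuousAt_pi.2 fun j => (hr 2 j).div hs' hs)
    (continuousAt_pi.2 fun j => (hi 2 j).div hs' hs)

theorem frameOfPoint_toSphere (w : UHR2) : frameOfPoint (toSphere w : CP2) = w.1 := by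
  rw [frameOfPoint_eq (isLift_toSphere w), frameOfVec_nullVec]

theorem continuousAt_frameOfPoint (w : UHR2) :
    ContinuousAt frameOfPoint (toSphere w : CP2) := by
  have h := isOpenQuotientMap_mk.continuousAt_comp_iff (g := frameOfPoint)
    (x := ⟨nullVec w, nullVec_ne_zero w⟩)
  refine h.1 ?_
  have e : frameOfPoint ∘
      (fun v : {v : Fin 3 → ℂ // v ≠ 0} => (Projectivization.mk ℂ v.1 v.2 : CP2)) =
      fun v => frameOfVec v.1 := funext fun v => frameOfPoint_eq (isLift_mk v.1 v.2)
  rw [e]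
  exact ContinuousAt.comp (g := frameOfVec) (f := Subtype.val) (continuousAt_frameOfVec w)
    continuous_subtype_val.continuousAt

theorem toSphere_injective : Function.Injective toSphere := fun w w' h => by
  apply Subtype.ext
  rw [← frameOfPoint_toSphere, h, frameOfPoint_toSphere]

/-- `frameOfPoint` is a left inverse that is continuous at each point of the image, which is enough
to compare neighbourhood filters; no continuity on the real circle is needed. -/
theorem isEmbedding_toSphere : IsEmbedding toSphere := by
  refine ⟨isInducing_iff_nhds.2 fun w => ?_, toSphere_injective⟩
  refine le_antisymm continuous_toSphere.continuousAt.le_comap ?_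
  have hw : 𝓝 w = Filter.comap Subtype.val (𝓝 w.1) := nhds_subtype_eq_comap
  rw [hw]
  have h : Filter.Tendsto (fun p : S3 => frameOfPoint (p : CP2)) (𝓝 (toSphere w)) (𝓝 w.1) := by
    have := ContinuousAt.comp (x := toSphere w) (continuousAt_frameOfPoint w)
      continuous_subtype_val.continuousAt
    rw [ContinuousAt, Function.comp_apply, frameOfPoint_toSphere] at this
    exact this
  refine le_trans (Filter.comap_mono h.le_comap) ?_
  rw [Filter.comap_comap]
  exact le_of_eq (congrArg (Filter.comap · _) (funext frameOfPoint_toSphere))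

/-- A complex square root rescales `v` to `cdot = -2`. With `herm = 0`, the real and imaginary parts
then have `mink` norms `-1` and `1` and are orthogonal; a change of sign puts the real part on the
upper sheet. -/
theorem exists_toSphere_eq {v : Fin 3 → ℂ} {p : S3} (hv : IsLift v (p : CP2))
    (hQ : cdot v v ≠ 0) : ∃ w, toSphere w = p := by
  have hn : herm v v = 0 := by
    obtain ⟨z, hz, h⟩ := p.2
    obtain ⟨c, -, rfl⟩ := hv.eq_smul hz
    rw [herm_smul, h, mul_zero]
  obtain ⟨c, hc⟩ := IsAlgClosed.exists_pow_nat_eq (-2 / cdot v v) two_pos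
  have hc0 : c ≠ 0 := by
    rintro rfl
    rw [zero_pow two_ne_zero, eq_comm, div_eq_zero_iff] at hc
    exact hc.elim (by norm_num) hQ
  have key : ∃ d : ℂ, d ≠ 0 ∧ cdot (d • v) (d • v) = -2 ∧ 0 ≤ ((d • v) 2).re := by
    have h2 : cdot (c • v) (c • v) = -2 := by rw [cdot_smul, hc, div_mul_cancel₀ _ hQ]
    rcases le_total 0 ((c • v) 2).re with h | h
    · exact ⟨c, hc0, h2, h⟩
    · refine ⟨-c, neg_ne_zero.2 hc0, ?_, ?_⟩
      · rw [cdot_smul, neg_sq, ← cdot_smul, h2]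
      · simpa using h
  obtain ⟨d, hd, h1, h2⟩ := key
  have h3 : herm (d • v) (d • v) = 0 := by rw [herm_smul, hn, mul_zero]
  have hl := hv.smul hd
  generalize d • v = z at h1 h2 h3 hl
  have a1 := congrArg Complex.re h1
  have a2 := congrArg Complex.im h1
  have a3 := congrArg Complex.re h3
  simp [cdot, herm] at a1 a2 a3
  have hx : mink (fun i => (z i).re) (fun i => (z i).re) = -1 := by
    simp only [mink]; linarith
  have hpos : 0 < (z 2).re := by
    refine lt_of_le_of_ne h2 fun h0 => ?_
    simp only [mink, ← h0] at hx
    nlinarith [mul_self_nonneg (z 0).re, mul_self_nonneg (z 1).re]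
  refine ⟨⟨(fun i => (z i).re, fun i => -(z i).im), ⟨hx, hpos⟩, ?_, ?_⟩, ?_⟩
  · simp only [mink]; linarith
  · simp only [mink]; linarith
  · apply Subtype.ext
    refine (isLift_toSphere _).unique ?_
    convert hl using 1
    ext i
    simp only [nullVec, ofR, Pi.add_apply, Pi.smul_apply, smul_eq_mul]
    apply Complex.ext <;> simp

theorem mem_range_toSphere {v : Fin 3 → ℂ} {p : S3} (hv : IsLift v (p : CP2)) :
    p ∈ Set.range toSphere ↔ cdot v v ≠ 0 := by
  refine ⟨?_, exists_toSphere_eq hv⟩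
  rintro ⟨w, rfl⟩
  obtain ⟨c, hc, rfl⟩ := hv.eq_smul (isLift_toSphere w)
  rw [cdot_smul, cdot_nullVec]
  exact mul_ne_zero (pow_ne_zero 2 hc) (by norm_num)

theorem isOpen_range_toSphere : IsOpen (Set.range toSphere) := by
  have h : IsOpen {p : CP2 | ∃ v, IsLift v p ∧ cdot v v ≠ 0} := by
    rw [← isOpenQuotientMap_mk.isQuotientMap.isOpen_preimage]
    have : IsOpen {v : {v : Fin 3 → ℂ // v ≠ 0} | cdot v.1 v.1 ≠ 0} := by
      exact isOpen_ne_fun (continuous_cdot_self.comp continuous_subtype_val) continuous_const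
    convert this using 1
    ext v
    constructor
    · rintro ⟨z, hz, h⟩
      obtain ⟨c, hc, rfl⟩ := hz.eq_smul (isLift_mk v.1 v.2)
      rw [cdot_smul] at h
      exact right_ne_zero_of_mul h
    · exact fun h => ⟨v.1, isLift_mk v.1 v.2, h⟩
  convert h.preimage (continuous_subtype_val : Continuous (Subtype.val : S3 → CP2)) using 1
  ext p
  constructor
  · intro hp
    obtain ⟨v, hv⟩ := exists_isLift (p : CP2)
    exact ⟨v, hv, (mem_range_toSphere hv).1 hp⟩
  · rintro ⟨v, hv, h⟩
    exact (mem_range_toSphere hv).2 h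

theorem isOpenEmbedding_toSphere : IsOpenEmbedding toSphere :=
  ⟨isEmbedding_toSphere, isOpen_range_toSphere⟩

/-! ### Null vectors and fixed points -/

/-- After scaling the last coordinate to `1`, the hypotheses say `|z 0|² + |z 1|² = 1` and `(z 0)² +
(z 1)² = 1`. Comparing real parts forces the imaginary parts to vanish. -/
theorem exists_real_of_null {v : Fin 3 → ℂ} (hv : v ≠ 0) (h : herm v v = 0) (hQ : cdot v v = 0) :
    ∃ (c : ℂ) (a : Fin 3 → ℝ), c ≠ 0 ∧ mink a a = 0 ∧ a 2 = 1 ∧ v = c • ofR a := by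
  have h2 : v 2 ≠ 0 := by
    intro h2
    have a3 := congrArg Complex.re h
    simp [herm, h2] at a3
    refine hv (funext fun i => ?_)
    fin_cases i
    · apply Complex.ext <;> simp <;>
        nlinarith [mul_self_nonneg (v 0).re, mul_self_nonneg (v 0).im,
          mul_self_nonneg (v 1).re, mul_self_nonneg (v 1).im]
    · apply Complex.ext <;> simp <;>
        nlinarith [mul_self_nonneg (v 0).re, mul_self_nonneg (v 0).im,
          mul_self_nonneg (v 1).re, mul_self_nonneg (v 1).im]
    · exact h2
  have e : v = v 2 • ((v 2)⁻¹ • v) := by rw [smul_smul, mul_inv_cancel₀ h2, one_smul]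
  have h' : herm ((v 2)⁻¹ • v) ((v 2)⁻¹ • v) = 0 := by rw [herm_smul, h, mul_zero]
  have hQ' : cdot ((v 2)⁻¹ • v) ((v 2)⁻¹ • v) = 0 := by rw [cdot_smul, hQ, mul_zero]
  have hz : ((v 2)⁻¹ • v) 2 = 1 := by simp [h2]
  generalize (v 2)⁻¹ • v = z at e h' hQ' hz
  have a1 := congrArg Complex.re hQ'
  have a3 := congrArg Complex.re h'
  simp [cdot, herm, hz] at a1 a3
  have b0 : (z 0).im = 0 := by
    nlinarith [mul_self_nonneg (z 0).im, mul_self_nonneg (z 1).im]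
  have b1 : (z 1).im = 0 := by
    nlinarith [mul_self_nonneg (z 0).im, mul_self_nonneg (z 1).im]
  refine ⟨v 2, fun i => (z i).re, h2, ?_, by simp [hz], ?_⟩
  · simp [mink, hz]
    rw [b0, b1] at a1
    linarith
  · rw [e]
    congr 1
    · simp [hz]
    · ext i
      fin_cases i <;> apply Complex.ext <;> simp [ofR, b0, b1, hz]

theorem future_smul_pos (A : PO21) {y : Fin 3 → ℝ} (h : mink y y < 0) (h2 : 0 < y 2) :
    0 < ((A : GL (Fin 3) ℝ) • y) 2 := by
  have hs : 0 < √(-mink y y) := Real.sqrt_pos.2 (by linarith)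
  have h3 := A.2.2 ((√(-mink y y))⁻¹ • y) (by
    rw [mink_smul_left, mink_smul_right, ← mul_assoc, ← mul_inv,
      Real.mul_self_sqrt (by linarith), inv_neg, neg_mul, inv_mul_cancel₀ h.ne])
    (by simpa using mul_pos (inv_pos.2 hs) h2)
  rw [GL_smul_smul] at h3
  simpa [hs] using h3

/-- A future null vector is the limit of the future timelike vectors `a + s e₂` as `s` decreases to
`0`. -/
theorem null_smul_nonneg (A : PO21) {a : Fin 3 → ℝ} (h : mink a a = 0) (h2 : 0 < a 2) :
    0 ≤ ((A : GL (Fin 3) ℝ) • a) 2 := by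
  have key : ∀ s : ℝ, 0 < s →
      0 < ((A : GL (Fin 3) ℝ) • a) 2 + s * ((A : GL (Fin 3) ℝ) • (![0, 0, 1] : Fin 3 → ℝ)) 2 := by
    intro s hs
    have := future_smul_pos A (y := a + s • (![0, 0, 1] : Fin 3 → ℝ)) (by
      simp only [mink] at h
      simp [mink]
      nlinarith [mul_pos hs h2, mul_pos hs hs]) (by simp; positivity)
    rw [smul_add, GL_smul_smul] at this
    simpa using this
  have hlim : Filter.Tendsto (fun s : ℝ => ((A : GL (Fin 3) ℝ) • a) 2 +
      s * ((A : GL (Fin 3) ℝ) • (![0, 0, 1] : Fin 3 → ℝ)) 2) (𝓝[>] 0)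
      (𝓝 (((A : GL (Fin 3) ℝ) • a) 2)) := by
    have : ContinuousAt (fun s : ℝ => ((A : GL (Fin 3) ℝ) • a) 2 +
      s * ((A : GL (Fin 3) ℝ) • (![0, 0, 1] : Fin 3 → ℝ)) 2) 0 := by fun_prop
    have h' := this.tendsto
    simp only [zero_mul, add_zero] at h'
    exact h'.mono_left nhdsWithin_le_nhds
  exact ge_of_tendsto hlim (Filter.eventually_of_mem self_mem_nhdsWithin fun s hs => (key s hs).le)

theorem mink_nonpos_of_null {a b : Fin 3 → ℝ} (ha : mink a a = 0) (hb : mink b b = 0)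
    (ha2 : 0 < a 2) (hb2 : 0 < b 2) : mink a b ≤ 0 := by
  simp only [mink] at *
  have h : (a 0 * b 0 + a 1 * b 1) ^ 2 ≤ (a 2 * b 2) ^ 2 := by
    have : (a 2 * b 2) ^ 2 = (a 0 * a 0 + a 1 * a 1) * (b 0 * b 0 + b 1 * b 1) := by
      linear_combination (-(b 2 * b 2)) * ha - (a 0 * a 0 + a 1 * a 1) * hb
    nlinarith [sq_nonneg (a 0 * b 1 - a 1 * b 0)]
  have := abs_le_of_sq_le_sq' h (by positivity)
  linarith [this.2]

/-- Equality case of the reversed Cauchy–Schwarz inequality: the hypotheses make a sum of two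
squares vanish. -/
theorem proportional_of_null {a b : Fin 3 → ℝ} (ha : mink a a = 0) (hb : mink b b = 0)
    (h : mink a b = 0) (ha2 : 0 < a 2) : b = (b 2 / a 2) • a := by
  simp only [mink] at *
  have e : (b 2 * a 0 - a 2 * b 0) ^ 2 + (b 2 * a 1 - a 2 * b 1) ^ 2 = 0 := by
    linear_combination b 2 ^ 2 * ha + a 2 ^ 2 * hb - 2 * a 2 * b 2 * h
  have e0 : b 2 * a 0 - a 2 * b 0 = 0 := by
    nlinarith [sq_nonneg (b 2 * a 0 - a 2 * b 0), sq_nonneg (b 2 * a 1 - a 2 * b 1)]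
  have e1 : b 2 * a 1 - a 2 * b 1 = 0 := by
    nlinarith [sq_nonneg (b 2 * a 0 - a 2 * b 0), sq_nonneg (b 2 * a 1 - a 2 * b 1)]
  ext i
  fin_cases i <;> simp <;> field_simp <;> linarith

/-- `IsAttractive` allows any unitary lift; this shows that the modulus of an eigenvalue does not
depend on the choice. -/
theorem exists_unit_smul_of_mk_eq {A B : GL (Fin 3) ℂ} (hA : A ∈ U21) (hB : B ∈ U21)
    (h : Matrix.ProjGenLinGroup.mk A = Matrix.ProjGenLinGroup.mk B) :
    ∃ c : ℂ, ‖c‖ = 1 ∧ ∀ v : Fin 3 → ℂ, A • v = c • (B • v) := by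
  obtain ⟨u, hu⟩ := Matrix.ProjGenLinGroup.mk_eq_mk_iff.1 h
  have key : ∃ c : ℂ, ∀ v : Fin 3 → ℂ, A • v = c • (B • v) := by
    refine ⟨(u⁻¹ : ℂˣ), fun v => ?_⟩
    have hs : Matrix.GeneralLinearGroup.scalar (Fin 3) u • v = (u : ℂ) • v := by
      ext i
      simp [Units.smul_def, Matrix.smul_eq_mulVec, Matrix.mulVec_diagonal]
    rw [← hu, mul_smul, hs, GL_smul_smul, smul_smul, Units.inv_mul, one_smul]
  obtain ⟨c, hc⟩ := key
  refine ⟨c, ?_, hc⟩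
  have h1 := hA ![1, 0, 0] ![1, 0, 0]
  rw [hc, herm_smul, hB] at h1
  have h2 : ‖c‖ ^ 2 = 1 := Complex.ofReal_injective (by simpa [herm] using h1)
  exact (pow_eq_one_iff_of_nonneg (norm_nonneg c) two_ne_zero).1 h2

/-- An eigenvector whose eigenvalue `ν` has modulus greater than `1` satisfies `ν² (v.v) = v.v`, so
`v.v = 0` and the line is real. The eigenvalue is then real, and positive because the future cone is
preserved. -/
theorem exists_real_of_isAttractive {γ : PO21} {p : S3} (h : IsAttractive (toPU γ) p) :
    ∃ (a : Fin 3 → ℝ) (μ : ℝ), 1 < μ ∧ IsLift (ofR a) (p : CP2) ∧ mink a a = 0 ∧ 0 < a 2 ∧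
      (γ : GL (Fin 3) ℝ) • a = μ • a := by
  obtain ⟨A, hA, hmk, v, hv, μ, hμ, e⟩ := h
  obtain ⟨c, hc, hcv⟩ := exists_unit_smul_of_mk_eq hA (map_mem_U21 γ) hmk
  have hc0 : c ≠ 0 := by rintro rfl; simp at hc
  have e' : complexify γ • v = (μ / c) • v := by
    rw [hcv] at e
    rw [div_eq_inv_mul, mul_smul, ← e, smul_smul, inv_mul_cancel₀ hc0, one_smul]
  have hν : 1 < ‖μ / c‖ := by rw [norm_div, hc, div_one]; exact hμ
  generalize μ / c = ν at e' hν
  have hQ : cdot v v = 0 := by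
    have h1 := cdot_complexify γ v v
    rw [e', cdot_smul] at h1
    by_contra h0
    have h2 : ν ^ 2 = 1 := by
      rw [← mul_left_inj' h0, h1, one_mul]
    have h3 := congrArg norm h2
    rw [norm_pow, norm_one] at h3
    nlinarith
  have hn : herm v v = 0 := by
    obtain ⟨z, hz, h⟩ := p.2
    obtain ⟨d, -, rfl⟩ := hv.eq_smul hz
    rw [herm_smul, h, mul_zero]
  obtain ⟨d, a, hd, ha, ha2, rfl⟩ := exists_real_of_null hv.1 hn hQ
  rw [GL_smul_smul, complexify_smul_ofR, smul_comm] at e'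
  have e2 := smul_right_injective _ hd e'
  have e3 : ν = ((((γ : GL (Fin 3) ℝ) • a) 2 : ℝ) : ℂ) := by
    have := congrFun e2 2
    simpa [ofR, ha2] using this.symm
  rw [e3, Complex.norm_real,
    Real.norm_of_nonneg (null_smul_nonneg γ ha (by rw [ha2]; exact one_pos))]
    at hν
  refine ⟨a, _, hν, ?_, ha, by rw [ha2]; exact one_pos, ?_⟩
  · have := hv.smul (inv_ne_zero hd)
    rwa [smul_smul, inv_mul_cancel₀ hd, one_smul] at this
  · ext i
    have := congrFun e2 i
    rw [e3] at this
    simp only [ofR, Pi.smul_apply, smul_eq_mul] at this ⊢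
    exact_mod_cast this

theorem isAttractive_of_real {γ : PO21} {p : S3} {a : Fin 3 → ℝ} {μ : ℝ} (hμ : 1 < μ)
    (hp : IsLift (ofR a) (p : CP2)) (h : (γ : GL (Fin 3) ℝ) • a = μ • a) :
    IsAttractive (toPU γ) p := by
  refine ⟨complexify γ, map_mem_U21 γ, rfl, ofR a, hp, μ, ?_, ?_⟩
  · rw [Complex.norm_real, Real.norm_of_nonneg (by linarith)]
    exact hμ
  · rw [complexify_smul_ofR, h]
    ext i
    simp [ofR]

/-- The point of the sphere with a given real null lift. -/
def realPoint (a : Fin 3 → ℝ) (h : mink a a = 0) (h2 : 0 < a 2) : S3 :=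
  ⟨Projectivization.mk ℂ (ofR a) (ofR_ne_zero h2), ofR a, isLift_mk _ _, by
    rw [herm_ofR, h, Complex.ofReal_zero]⟩

theorem isLift_realPoint (a : Fin 3 → ℝ) (h : mink a a = 0) (h2 : 0 < a 2) :
    IsLift (ofR a) (realPoint a h h2 : CP2) := isLift_mk _ _

/-! ### Axes -/

theorem mink_plus (w : UHR2) : mink (w.1.1 + w.1.2) (w.1.1 + w.1.2) = 0 := by
  rw [mink_add_left, mink_add_right, mink_add_right, w.2.1.1, mink_comm w.1.2 w.1.1, w.2.2.1,
    w.2.2.2]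
  ring

theorem mink_minus (w : UHR2) : mink (w.1.1 - w.1.2) (w.1.1 - w.1.2) = 0 := by
  rw [mink_sub_left, mink_sub_right, mink_sub_right, w.2.1.1, mink_comm w.1.2 w.1.1, w.2.2.1,
    w.2.2.2]
  ring

theorem mink_minus_plus (w : UHR2) : mink (w.1.1 - w.1.2) (w.1.1 + w.1.2) = -2 := by
  rw [mink_sub_left, mink_add_right, mink_add_right, w.2.1.1, mink_comm w.1.2 w.1.1, w.2.2.1,
    w.2.2.2]
  ring

theorem plus_pos (w : UHR2) : 0 < (w.1.1 + w.1.2) 2 := by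
  have := abs_lt.1 (abs_snd_lt w)
  simp only [Pi.add_apply]
  linarith

theorem minus_pos (w : UHR2) : 0 < (w.1.1 - w.1.2) 2 := by
  have := abs_lt.1 (abs_snd_lt w)
  simp only [Pi.sub_apply]
  linarith

/-- In the null coordinates `x + u`, `x - u` the flow is diagonal, with factors `exp t` and `exp
(-t)`. These vectors represent the forward and backward endpoints of the geodesic. -/
theorem geodesicFlow_plus (t : ℝ) (w : UHR2) :
    (geodesicFlow t w).1.1 + (geodesicFlow t w).1.2 = Real.exp t • (w.1.1 + w.1.2) := by
  rw [← Real.cosh_add_sinh]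
  simp only [geodesicFlow]
  module

theorem geodesicFlow_minus (t : ℝ) (w : UHR2) :
    (geodesicFlow t w).1.1 - (geodesicFlow t w).1.2 = Real.exp (-t) • (w.1.1 - w.1.2) := by
  rw [← Real.cosh_sub_sinh]
  simp only [geodesicFlow]
  module

theorem UHR2_ext {w w' : UHR2} (h : w.1.1 + w.1.2 = w'.1.1 + w'.1.2)
    (h' : w.1.1 - w.1.2 = w'.1.1 - w'.1.2) : w = w' := by
  refine Subtype.ext (Prod.ext ?_ ?_) <;> ext i <;>
    · have e := congrFun h i
      have e' := congrFun h' i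
      simp only [Pi.add_apply, Pi.sub_apply] at e e'
      linarith

theorem smul_plus (A : PO21) (w : UHR2) :
    (A • w).1.1 + (A • w).1.2 = (A : GL (Fin 3) ℝ) • (w.1.1 + w.1.2) :=
  (smul_add (A : GL (Fin 3) ℝ) w.1.1 w.1.2).symm

theorem smul_minus (A : PO21) (w : UHR2) :
    (A • w).1.1 - (A • w).1.2 = (A : GL (Fin 3) ℝ) • (w.1.1 - w.1.2) :=
  (smul_sub (A : GL (Fin 3) ℝ) w.1.1 w.1.2).symm

theorem geodesicFlow_zero (w : UHR2) : geodesicFlow 0 w = w := by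
  apply UHR2_ext
  · rw [geodesicFlow_plus, Real.exp_zero, one_smul]
  · rw [geodesicFlow_minus, neg_zero, Real.exp_zero, one_smul]

theorem geodesicFlow_add (s t : ℝ) (w : UHR2) :
    geodesicFlow (s + t) w = geodesicFlow s (geodesicFlow t w) := by
  apply UHR2_ext
  · rw [geodesicFlow_plus, geodesicFlow_plus, geodesicFlow_plus, smul_smul, Real.exp_add]
  · rw [geodesicFlow_minus, geodesicFlow_minus, geodesicFlow_minus, smul_smul, ← Real.exp_add,
      neg_add]

theorem smul_geodesicFlow (A : PO21) (t : ℝ) (w : UHR2) :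
    A • geodesicFlow t w = geodesicFlow t (A • w) := by
  apply UHR2_ext
  · rw [geodesicFlow_plus, smul_plus, smul_plus, geodesicFlow_plus, GL_smul_smul]
  · rw [geodesicFlow_minus, smul_minus, smul_minus, geodesicFlow_minus, GL_smul_smul]

theorem geodesicFlow_mem_liftedAxis {γ : PO21} {w : UHR2} (h : w ∈ liftedAxis γ) (t : ℝ) :
    geodesicFlow t w ∈ liftedAxis γ := by
  obtain ⟨l, hl, e⟩ := h
  exact ⟨l, hl, by rw [smul_geodesicFlow, e, ← geodesicFlow_add, ← geodesicFlow_add, add_comm]⟩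

/-- `γ` expands `x + u` and `x' + u'`, so invariance makes their `mink` product zero and they are
proportional; likewise for the minus vectors, which it contracts. The normalization
`mink_minus_plus` makes the two ratios inverse to each other, so they come from a single flow time.
-/
theorem exists_geodesicFlow_eq {γ : PO21} {w w' : UHR2} (h : w ∈ liftedAxis γ)
    (h' : w' ∈ liftedAxis γ) : ∃ t, w' = geodesicFlow t w := by
  obtain ⟨l, hl, e⟩ := h
  obtain ⟨l', hl', e'⟩ := h'
  have hp : mink (w.1.1 + w.1.2) (w'.1.1 + w'.1.2) = 0 := by
    have h := γ.2.1 (w.1.1 + w.1.2) (w'.1.1 + w'.1.2)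
    rw [← smul_plus, ← smul_plus, e, e', geodesicFlow_plus, geodesicFlow_plus, mink_smul_left,
      mink_smul_right, ← mul_assoc, ← Real.exp_add] at h
    by_contra h0
    have := (mul_eq_right₀ h0).1 h
    rw [Real.exp_eq_one_iff] at this
    linarith
  have hm : mink (w.1.1 - w.1.2) (w'.1.1 - w'.1.2) = 0 := by
    have h := γ.2.1 (w.1.1 - w.1.2) (w'.1.1 - w'.1.2)
    rw [← smul_minus, ← smul_minus, e, e', geodesicFlow_minus, geodesicFlow_minus, mink_smul_left,
      mink_smul_right, ← mul_assoc, ← Real.exp_add] at h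
    by_contra h0
    have := (mul_eq_right₀ h0).1 h
    rw [Real.exp_eq_one_iff] at this
    linarith
  have kp := proportional_of_null (mink_plus w) (mink_plus w') hp (plus_pos w)
  have km := proportional_of_null (mink_minus w) (mink_minus w') hm (minus_pos w)
  have hk := div_pos (plus_pos w') (plus_pos w)
  generalize (w'.1.1 + w'.1.2) 2 / (w.1.1 + w.1.2) 2 = k at kp hk
  generalize (w'.1.1 - w'.1.2) 2 / (w.1.1 - w.1.2) 2 = k' at km
  have hkk := mink_minus_plus w'
  rw [kp, km, mink_smul_left, mink_smul_right, mink_minus_plus] at hkk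
  refine ⟨Real.log k, UHR2_ext ?_ ?_⟩
  · rw [geodesicFlow_plus, Real.exp_log hk, kp]
  · rw [geodesicFlow_minus, Real.exp_neg, Real.exp_log hk, km]
    congr 1
    field_simp
    linarith

theorem liftedAxis_eq_range {γ : PO21} {w : UHR2} (h : w ∈ liftedAxis γ) :
    liftedAxis γ = Set.range fun t => geodesicFlow t w := by
  ext w'
  constructor
  · intro h'
    obtain ⟨t, rfl⟩ := exists_geodesicFlow_eq h h'
    exact ⟨t, rfl⟩
  · rintro ⟨t, rfl⟩
    exact geodesicFlow_mem_liftedAxis h t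

theorem smul_eq_inv_smul_of_smul_eq {A : GL (Fin 3) ℝ} {a : Fin 3 → ℝ} {μ : ℝ} (hμ : μ ≠ 0)
    (h : A • a = μ • a) : A⁻¹ • a = μ⁻¹ • a := by
  rw [inv_smul_eq_iff, GL_smul_smul, h, smul_smul, inv_mul_cancel₀ hμ, one_smul]

theorem isAttractive_plus {γ : PO21} {w : UHR2} (h : w ∈ liftedAxis γ) :
    IsAttractive (toPU γ) (realPoint _ (mink_plus w) (plus_pos w)) := by
  obtain ⟨l, hl, e⟩ := h
  refine isAttractive_of_real (Real.one_lt_exp_iff.2 hl) (isLift_realPoint _ _ _) ?_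
  rw [← smul_plus, e, geodesicFlow_plus]

theorem isRepulsive_minus {γ : PO21} {w : UHR2} (h : w ∈ liftedAxis γ) :
    IsRepulsive (toPU γ) (realPoint _ (mink_minus w) (minus_pos w)) := by
  obtain ⟨l, hl, e⟩ := h
  rw [IsRepulsive, ← map_inv]
  refine isAttractive_of_real (Real.one_lt_exp_iff.2 hl) (isLift_realPoint _ _ _) ?_
  have := smul_eq_inv_smul_of_smul_eq (A := (γ : GL (Fin 3) ℝ)) (a := w.1.1 - w.1.2)
    (Real.exp_ne_zero (-l)) (by rw [← smul_minus, e, geodesicFlow_minus])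
  rwa [← Real.exp_neg, neg_neg] at this

theorem isLoxodromic_of_mem_liftedAxis {γ : PO21} {w : UHR2} (h : w ∈ liftedAxis γ) :
    IsLoxodromic (toPU γ) :=
  ⟨⟨_, isRepulsive_minus h⟩, _, isAttractive_plus h⟩

theorem toSphere_mem_axisAtInfinity {γ : PO21} {w : UHR2} (h : w ∈ liftedAxis γ) :
    toSphere w ∈ axisAtInfinity (toPU γ) := by
  -- The factor `1/2` gives `⟨A, B⟩ = -1`, and at `y = 2` one has `2iA + B = i(x - u) + (x + u) = (1
  -- + i)(x - i u)`.
  refine ⟨_, _, isRepulsive_minus h, isAttractive_plus h, (2⁻¹ : ℂ) • ofR (w.1.1 - w.1.2),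
    ofR (w.1.1 + w.1.2), (isLift_realPoint _ _ _).smul (by norm_num), isLift_realPoint _ _ _,
    ?_, 2, two_pos, ?_⟩
  · rw [← one_smul ℂ (ofR (w.1.1 + w.1.2)), herm_smul_smul, herm_ofR, mink_minus_plus]
    norm_num
  · convert (isLift_toSphere w).smul (c := 1 + Complex.I) (fun h => by
      simpa using congrArg Complex.re h) using 1
    ext i
    simp only [nullVec, ofR, Pi.add_apply, Pi.sub_apply, Pi.smul_apply, smul_eq_mul]
    push_cast
    linear_combination (w.1.2 i : ℂ) * Complex.I_sq

/-- The parameter `τ` selects the point on the geodesic from `[A]` to `[B]`. The scale `s` is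
dictated by `mink_minus_plus`, that is, `s² τ mink A B = -2`. -/
theorem exists_frame_of_null {A B : Fin 3 → ℝ} (hA : mink A A = 0) (hB : mink B B = 0)
    (hA2 : 0 < A 2) (hB2 : 0 < B 2) (h : mink A B ≠ 0) {τ : ℝ} (hτ : 0 < τ) :
    ∃ (w : UHR2) (s : ℝ), 0 < s ∧ w.1.1 + w.1.2 = s • B ∧ w.1.1 - w.1.2 = (s * τ) • A := by
  have hm : 0 < -mink A B := by
    have := mink_nonpos_of_null hA hB hA2 hB2
    have := lt_of_le_of_ne this h
    linarith
  have hs : 0 < √(2 / (τ * -mink A B)) := Real.sqrt_pos.2 (by positivity)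
  have hs2 : √(2 / (τ * -mink A B)) ^ 2 * (τ * mink A B) = -2 := by
    rw [Real.sq_sqrt (by positivity)]
    field_simp
  generalize √(2 / (τ * -mink A B)) = s at hs hs2
  refine ⟨⟨((s / 2) • (B + τ • A), (s / 2) • (B - τ • A)), ⟨?_, ?_⟩, ?_, ?_⟩, s, hs, ?_, ?_⟩
  · simp only [mink_smul_left, mink_smul_right, mink_add_left, mink_add_right, hA, hB,
      mink_comm B A]
    linear_combination hs2 / 2
  · simp
    positivity
  · simp only [mink_smul_left, mink_smul_right, mink_add_left, mink_sub_right,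
      hA, hB, mink_comm B A]
    ring
  · simp only [mink_smul_left, mink_smul_right, mink_sub_left, mink_sub_right, hA, hB,
      mink_comm B A]
    linear_combination -hs2 / 2
  · module
  · module

theorem axisAtInfinity_subset {γ : PO21} :
    axisAtInfinity (toPU γ) ⊆ toSphere '' liftedAxis γ := by
  rintro p ⟨a, b, ha, hb, A, B, hAa, hBb, hAB, y, hy, hp⟩
  rw [IsRepulsive, ← map_inv] at ha
  obtain ⟨A', μ, hμ, hA', nA, pA, eA⟩ := exists_real_of_isAttractive ha
  obtain ⟨B', ν, hν, hB', nB, pB, eB⟩ := exists_real_of_isAttractive hb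
  have eA' : (γ : GL (Fin 3) ℝ) • A' = μ⁻¹ • A' := by
    have := smul_eq_inv_smul_of_smul_eq (by linarith) eA
    simpa using this
  obtain ⟨c, hc, rfl⟩ := hAa.eq_smul hA'
  obtain ⟨d, hd, rfl⟩ := hBb.eq_smul hB'
  rw [herm_smul_smul, herm_ofR] at hAB
  have hm : mink A' B' ≠ 0 := by
    intro h
    rw [h] at hAB
    simp at hAB
  -- The eigenvalues on the two fixed null lines are inverse to each other, since `mink A' B'` is
  -- nonzero and preserved.
  have hμν : ν = μ := by
    have h := γ.2.1 A' B'
    rw [eA', eB, mink_smul_left, mink_smul_right, ← mul_assoc] at h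
    have := (mul_eq_right₀ hm).1 h
    field_simp at this
    exact this
  subst hμν
  have hm' : 0 < -mink A' B' := by
    have := lt_of_le_of_ne (mink_nonpos_of_null nA nB pA pB) hm
    linarith
  -- With `m = -mink A' B'`, the condition `⟨A, B⟩ = -1` reads `d c̄ m = 1`. Multiplying `i y c A' +
  -- d B'` by `c̄ m` therefore gives `i τ A' + B'` with `τ = y |c|² m`; a further factor `s (1 - i)
  -- / 2` turns this into `x - i u`.
  obtain ⟨w, s, hs, wp, wm⟩ := exists_frame_of_null nA nB pA pB hm
    (τ := y * ‖c‖ ^ 2 * -mink A' B') (by positivity)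
  refine ⟨w, ⟨Real.log ν, Real.log_pos hν, UHR2_ext ?_ ?_⟩, ?_⟩
  · rw [smul_plus, geodesicFlow_plus, wp, GL_smul_smul, eB, Real.exp_log (by linarith), smul_comm]
  · rw [smul_minus, geodesicFlow_minus, wm, GL_smul_smul, eA', Real.exp_neg,
      Real.exp_log (by linarith), smul_comm]
  · apply Subtype.ext
    refine (isLift_toSphere w).unique ?_
    have hd' : d * (star c * (-mink A' B' : ℝ)) = 1 := by
      have := congrArg star hAB
      simp at this
      push_cast
      simp
      linear_combination -this
    convert hp.smul (c := ((s : ℂ) * (1 - Complex.I) / 2) * (star c * ((-mink A' B' : ℝ) : ℂ))) ?_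
      using 1
    · have hx : w.1.1 = (s / 2) • (B' + (y * ‖c‖ ^ 2 * -mink A' B') • A') := by
        have : w.1.1 = (2⁻¹ : ℝ) • ((w.1.1 + w.1.2) + (w.1.1 - w.1.2)) := by module
        rw [this, wp, wm]
        module
      have hu : w.1.2 = (s / 2) • (B' - (y * ‖c‖ ^ 2 * -mink A' B') • A') := by
        have : w.1.2 = (2⁻¹ : ℝ) • ((w.1.1 + w.1.2) - (w.1.1 - w.1.2)) := by module
        rw [this, wp, wm]
        module
      have hcc : c * star c = ((‖c‖ ^ 2 : ℝ) : ℂ) := by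
        rw [Complex.star_def, Complex.mul_conj, Complex.normSq_eq_norm_sq]
      rw [nullVec, hx, hu]
      generalize -mink A' B' = m at *
      generalize ‖c‖ ^ 2 = r at *
      ext i
      simp only [ofR, Pi.add_apply, Pi.sub_apply, Pi.smul_apply, smul_eq_mul]
      push_cast at *
      linear_combination
        (-(s : ℂ) * (1 - Complex.I) / 2 * B' i) * hd' -
        ((s : ℂ) * (1 - Complex.I) / 2 * Complex.I * y * m * A' i) * hcc +
        ((s : ℂ) / 2 * y * r * m * A' i) * Complex.I_sq
    · refine mul_ne_zero (div_ne_zero (mul_ne_zero (by exact_mod_cast hs.ne') fun h => ?_)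
        two_ne_zero) (right_ne_zero_of_mul_eq_one hd')
      simpa using congrArg Complex.re h

theorem axisAtInfinity_eq (γ : PO21) : axisAtInfinity (toPU γ) = toSphere '' liftedAxis γ := by
  refine axisAtInfinity_subset.antisymm ?_
  rintro _ ⟨w, hw, rfl⟩
  exact toSphere_mem_axisAtInfinity hw

theorem mem_translate_axis {γ g : PO21} {w : UHR2} :
    toSphere w ∈ translate (toPU g) (axisAtInfinity (toPU γ)) ↔ g⁻¹ • w ∈ liftedAxis γ := by
  rw [axisAtInfinity_eq]
  constructor
  · rintro ⟨_, ⟨w', hw', rfl⟩, e⟩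
    dsimp only at e
    rw [← toSphere_smul] at e
    rw [← toSphere_injective e, inv_smul_smul]
    exact hw'
  · intro h
    refine ⟨_, ⟨_, h, rfl⟩, ?_⟩
    dsimp only
    rw [← toSphere_smul, smul_inv_smul]

theorem translate_axis_subset_range (γ g : PO21) :
    translate (toPU g) (axisAtInfinity (toPU γ)) ⊆ Set.range toSphere := by
  rw [axisAtInfinity_eq]
  rintro _ ⟨_, ⟨w', hw', rfl⟩, rfl⟩
  exact ⟨g • w', toSphere_smul g w'⟩

theorem inv_smul_mem_liftedAxis {γ g h : PO21} {w w' : UHR2} (hg : g⁻¹ • w ∈ liftedAxis γ)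
    (hh : h⁻¹ • w ∈ liftedAxis γ) (hw' : g⁻¹ • w' ∈ liftedAxis γ) : h⁻¹ • w' ∈ liftedAxis γ := by
  obtain ⟨t, e⟩ := exists_geodesicFlow_eq hg hw'
  rw [← smul_geodesicFlow, smul_left_cancel_iff] at e
  rw [e, smul_geodesicFlow]
  exact geodesicFlow_mem_liftedAxis hh t

/-- Through `toSphere`, each translate is a single orbit of the geodesic flow, so two that share a
point are equal. -/
theorem crownEmbedded (Γ : Subgroup PO21) (γ : PO21) : CrownEmbedded (Γ.map toPU) (toPU γ) := by
  rintro _ ⟨g, -, rfl⟩ _ ⟨h, -, rfl⟩ hne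
  rw [Set.disjoint_iff_forall_ne]
  rintro p hp _ hq rfl
  apply hne
  obtain ⟨w, rfl⟩ := translate_axis_subset_range _ _ hp
  rw [mem_translate_axis] at hp hq
  ext q
  constructor
  · intro hq'
    obtain ⟨w', rfl⟩ := translate_axis_subset_range _ _ hq'
    exact mem_translate_axis.2 (inv_smul_mem_liftedAxis hp hq (mem_translate_axis.1 hq'))
  · intro hq'
    obtain ⟨w', rfl⟩ := translate_axis_subset_range _ _ hq'
    exact mem_translate_axis.2 (inv_smul_mem_liftedAxis hq hp (mem_translate_axis.1 hq'))

/-! ### The limit set -/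

theorem continuous_GL_smul (A : GL (Fin 3) ℝ) : Continuous fun x : Fin 3 → ℝ => A • x := by
  simp only [Units.smul_def, Matrix.smul_eq_mulVec]
  exact continuous_const.matrix_mulVec continuous_id

instance : ContinuousConstSMul PO21 HR2 where
  continuous_const_smul A :=
    ((continuous_GL_smul A).comp continuous_subtype_val).subtype_mk _

instance : ContinuousConstSMul PO21 UHR2 where
  continuous_const_smul A :=
    (((continuous_GL_smul A).comp (continuous_fst.comp continuous_subtype_val)).prodMk
      ((continuous_GL_smul A).comp (continuous_snd.comp continuous_subtype_val))).subtype_mk _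

instance (Γ : Subgroup PO21) : ContinuousConstSMul Γ HR2 where
  continuous_const_smul g := continuous_const_smul (g : PO21)

instance (Γ : Subgroup PO21) : ContinuousConstSMul Γ UHR2 where
  continuous_const_smul g := continuous_const_smul (g : PO21)

/-- The height `x 2` is the hyperbolic cosine of the distance to the origin. The images of the
sublevel sets form an increasing open cover of the compact quotient. -/
theorem exists_bound_of_compactSpace (Γ : Subgroup PO21) [CompactSpace (Surface Γ)] :
    ∃ C : ℝ, 0 < C ∧ ∀ x : HR2, ∃ g ∈ Γ, (g • x).1 2 < C := by
  let q : HR2 → Surface Γ := Quotient.mk _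
  have hopen : ∀ n : ℕ, IsOpen (q '' {x : HR2 | x.1 2 < n}) := fun n =>
    isOpenMap_quotient_mk'_mul _ (isOpen_lt
      ((continuous_apply 2).comp continuous_subtype_val) continuous_const)
  obtain ⟨n, hn⟩ := isCompact_univ.elim_directed_cover _ hopen (fun y _ => by
      obtain ⟨x, rfl⟩ := Quotient.exists_rep y
      obtain ⟨n, hn⟩ := exists_nat_gt (x.1 2)
      exact Set.mem_iUnion.2 ⟨n, x, hn, rfl⟩)
    (directed_of_isDirected_le fun m n hmn => Set.image_mono fun x (hx : x.1 2 < m) =>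
      lt_of_lt_of_le hx (Nat.cast_le.2 hmn))
  refine ⟨n + 1, by positivity, fun x => ?_⟩
  obtain ⟨y, hy, e⟩ := hn (Set.mem_univ (q x))
  obtain ⟨g, hg⟩ := MulAction.orbitRel_apply.1 (Quotient.exact e)
  refine ⟨g, g.2, ?_⟩
  have h : (g : PO21) • x = y := hg
  rw [h]
  exact lt_trans hy (lt_add_one _)

/-- The ratio `|v.v| / |⟨v, v⟩|` is invariant under scaling and under `Γ`, hence constant on an
orbit. It would be infinite at a limit point `[x - i u]`, where `⟨v, v⟩ = 0` and `v.v = -2`. -/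
theorem limitSet_disjoint_range (Γ : Subgroup PO21) (w : UHR2) :
    toSphere w ∉ limitSet (Γ.map toPU) := by
  rintro ⟨x, ⟨z, hz, hneg⟩, hcl⟩
  -- The bound on the ratio, with denominators cleared so that it defines a closed set including
  -- null vectors.
  let C : Set CP2 := {q | ∀ v, IsLift v q →
    ‖cdot v v‖ * ‖herm z z‖ ≤ ‖cdot z z‖ * ‖herm v v‖}
  have hiff : ∀ {v q}, IsLift v q →
      (q ∈ C ↔ ‖cdot v v‖ * ‖herm z z‖ ≤ ‖cdot z z‖ * ‖herm v v‖) := by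
    intro v q hv
    refine ⟨fun h => h v hv, fun h u hu => ?_⟩
    obtain ⟨c, hc, rfl⟩ := hu.eq_smul hv
    rw [cdot_smul, herm_smul, norm_mul, norm_mul, norm_pow, Complex.norm_real, norm_pow, norm_norm]
    nlinarith [mul_le_mul_of_nonneg_left h (sq_nonneg ‖c‖)]
  have hC : IsClosed C := by
    rw [← isOpenQuotientMap_mk.isQuotientMap.isClosed_preimage]
    have h : IsClosed {v : {v : Fin 3 → ℂ // v ≠ 0} |
        ‖cdot v.1 v.1‖ * ‖herm z z‖ ≤ ‖cdot z z‖ * ‖herm v.1 v.1‖} := by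
      have h1 : Continuous fun v : Fin 3 → ℂ => herm v v := by
        unfold herm
        fun_prop
      exact isClosed_le
        ((continuous_cdot_self.comp continuous_subtype_val).norm.mul continuous_const)
        (continuous_const.mul (h1.comp continuous_subtype_val).norm)
    convert h using 1
    ext v
    exact hiff (isLift_mk v.1 v.2)
  have hsub : {y : CP2 | ∃ g ∈ Γ.map toPU, y = (g : PGL(3, ℂ)) • x} ⊆ C := by
    rintro _ ⟨_, ⟨g, -, rfl⟩, rfl⟩
    rw [hiff (isLift_toPU_smul g hz), cdot_complexify, map_mem_U21]
  have h := (hiff (isLift_toSphere w)).1 (closure_minimal hsub hC hcl)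
  rw [herm_nullVec, cdot_nullVec, norm_zero, mul_zero] at h
  have hpos : 0 < ‖herm z z‖ := norm_pos_iff.2 fun h0 => by
    rw [h0] at hneg
    exact lt_irrefl _ hneg
  norm_num at h
  linarith

/-- The base point of the hyperboloid. -/
def origin : HR2 := ⟨![0, 0, 1], by simp [mink], by simp⟩

/-- The hypothesis bounds below the `mink` product of `y` with `(s a, t)`. Dividing by `y 2 ≥ 1`
shows that, in the Klein model, `y` is close to the boundary point `a` once `s` is large. -/
theorem sq_dist_le_of_mink_gt {a y : Fin 3 → ℝ} {s t C : ℝ} (ha : a 0 ^ 2 + a 1 ^ 2 = 1)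
    (hy : mink y y = -1) (hy2 : 0 < y 2) (hs : 0 < s) (hst : s ≤ t) (hC : 0 < C)
    (h : -C < s * (y 0 * a 0 + y 1 * a 1) - t * y 2) :
    (y 0 / y 2 - a 0) ^ 2 + (y 1 / y 2 - a 1) ^ 2 ≤ 2 * C / s := by
  simp only [mink] at hy
  have h1 : 1 ≤ y 2 := by nlinarith [mul_self_nonneg (y 0), mul_self_nonneg (y 1)]
  have e : (y 0 / y 2 - a 0) ^ 2 + (y 1 / y 2 - a 1) ^ 2 =
      2 - 1 / y 2 ^ 2 - 2 * ((y 0 * a 0 + y 1 * a 1) / y 2) := by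
    field_simp
    linear_combination hy + y 2 ^ 2 * ha
  have h2 : 1 - C / s ≤ (y 0 * a 0 + y 1 * a 1) / y 2 := by
    rw [le_div_iff₀ hy2]
    have h3 : s * ((1 - C / s) * y 2) ≤ s * (y 0 * a 0 + y 1 * a 1) := by
      have : s * ((1 - C / s) * y 2) = s * y 2 - C * y 2 := by field_simp
      rw [this]
      nlinarith
    exact le_of_mul_le_mul_left h3 hs
  have h4 : 0 ≤ 1 / y 2 ^ 2 := by positivity
  have h5 : 2 * C / s = 2 * (C / s) := by ring
  rw [e, h5]
  linarith

/-- Points `x n` tending to `a` are brought by `g n ∈ Γ` to bounded height. The orbit points `y n =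
(g n)⁻¹ • origin` stay within bounded distance of `x n`, so they also tend to `a`. -/
theorem mem_limitSet_of_real (Γ : Subgroup PO21) [CompactSpace (Surface Γ)] {a : Fin 3 → ℝ}
    (ha : mink a a = 0) (ha2 : a 2 = 1) {p : S3} (hp : IsLift (ofR a) (p : CP2)) :
    p ∈ limitSet (Γ.map toPU) := by
  obtain ⟨C, hC, hb⟩ := exists_bound_of_compactSpace Γ
  have ha' : a 0 ^ 2 + a 1 ^ 2 = 1 := by
    simp only [mink, ha2] at ha
    linarith
  have horig : ofR origin.1 ≠ 0 := ofR_ne_zero origin.2.2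
  refine ⟨Projectivization.mk ℂ (ofR origin.1) horig, ⟨_, isLift_mk _ _, ?_⟩, ?_⟩
  · rw [herm_ofR, origin.2.1]
    norm_num
  let x : ℕ → HR2 := fun n => ⟨![(n + 1) * a 0, (n + 1) * a 1, √((n + 1) ^ 2 + 1)], by
    simp only [mink, Matrix.cons_val]
    rw [Real.mul_self_sqrt (by positivity)]
    linear_combination ((n : ℝ) + 1) ^ 2 * ha', by
    simp only [Matrix.cons_val]
    positivity⟩
  choose g hg hlt using fun n => hb (x n)
  let y : ℕ → HR2 := fun n => (g n)⁻¹ • origin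
  have hy : ∀ n, 0 < (y n).1 2 := fun n => (y n).2.2
  have hdist : ∀ n, ((y n).1 0 / (y n).1 2 - a 0) ^ 2 + ((y n).1 1 / (y n).1 2 - a 1) ^ 2 ≤
      2 * C / (n + 1) := by
    intro n
    refine sq_dist_le_of_mink_gt ha' (y n).2.1 (hy n) (by positivity)
      (Real.le_sqrt_of_sq_le (le_add_of_nonneg_right zero_le_one) :
        (n + 1 : ℝ) ≤ √((n + 1) ^ 2 + 1)) hC ?_
    -- Pairing with the origin reads off minus the height, so invariance turns the bound on `g n • x
    -- n` into one on `mink (y n) (x n)`.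
    have h1 : mink (y n).1 (x n).1 = -((g n • x n).1 2) := by
      have h2 := (g n).2.1 (y n).1 (x n).1
      have h3 : ((g n : GL (Fin 3) ℝ)) • (y n).1 = origin.1 :=
        congrArg Subtype.val (smul_inv_smul (g n) origin)
      rw [h3] at h2
      rw [← h2]
      simp only [mink, origin, Matrix.cons_val]
      change _ - 1 * (g n • x n).1 2 = _
      ring
    have h4 : (n + 1 : ℝ) * ((y n).1 0 * a 0 + (y n).1 1 * a 1) -
        √((n + 1 : ℝ) ^ 2 + 1) * (y n).1 2 = mink (y n).1 (x n).1 := by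
      simp only [mink, x, Matrix.cons_val]
      ring
    rw [h4, h1]
    exact neg_lt_neg (hlt n)
  have hlim : ∀ {f : ℕ → ℝ} {b : ℝ}, (∀ n, (f n - b) ^ 2 ≤ 2 * C / (n + 1)) →
      Filter.Tendsto f Filter.atTop (𝓝 b) := by
    intro f b hf
    rw [tendsto_iff_norm_sub_tendsto_zero]
    have h0 : Filter.Tendsto (fun n : ℕ => √(2 * C / ((n : ℝ) + 1))) Filter.atTop (𝓝 0) := by
      have h1 : Filter.Tendsto (fun n : ℕ => 2 * C / ((n : ℝ) + 1)) Filter.atTop (𝓝 0) :=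
        Filter.Tendsto.div_atTop tendsto_const_nhds
          (Filter.tendsto_atTop_add_const_right _ _ tendsto_natCast_atTop_atTop)
      have h2 := (Real.continuous_sqrt.tendsto 0).comp h1
      rwa [Real.sqrt_zero] at h2
    exact squeeze_zero (fun n => norm_nonneg _) (fun n => Real.abs_le_sqrt (hf n)) h0
  have hmem : ∀ n, (Projectivization.mk ℂ (ofR (y n).1) (ofR_ne_zero (hy n)) : CP2) ∈
      {z : CP2 | ∃ g ∈ Γ.map toPU, z = (g : PGL(3, ℂ)) •
        (Projectivization.mk ℂ (ofR origin.1) horig : CP2)} := by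
    intro n
    refine ⟨toPU (g n)⁻¹, ⟨_, Γ.inv_mem (hg n), rfl⟩, (isLift_mk _ _).unique ?_⟩
    have := isLift_toPU_smul (g n)⁻¹ (isLift_mk (ofR origin.1) horig)
    rwa [complexify_smul_ofR] at this
  have hne : ∀ n, ofR (((y n).1 2)⁻¹ • (y n).1) ≠ 0 := fun n => ofR_ne_zero (by
    rw [Pi.smul_apply, smul_eq_mul, inv_mul_cancel₀ (hy n).ne']
    exact one_pos)
  have htend : Filter.Tendsto
      (fun n => (Projectivization.mk ℂ (ofR (((y n).1 2)⁻¹ • (y n).1)) (hne n) : CP2))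
      Filter.atTop (𝓝 (p : CP2)) := by
    obtain ⟨ha0, e⟩ := hp
    rw [← e]
    refine (isOpenQuotientMap_mk.continuous.tendsto (⟨ofR a, ha0⟩ : {v : Fin 3 → ℂ // v ≠ 0})).comp
      (f := fun n => (⟨_, hne n⟩ : {v : Fin 3 → ℂ // v ≠ 0})) (tendsto_subtype_rng.2 ?_)
    rw [tendsto_pi_nhds]
    intro i
    refine (Complex.continuous_ofReal.tendsto (a i)).comp ?_
    simp only [Pi.smul_apply, smul_eq_mul]
    fin_cases i
    · refine hlim fun n => le_trans ?_ (hdist n)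
      simp only [Fin.zero_eta, inv_mul_eq_div]
      linarith [sq_nonneg ((y n).1 1 / (y n).1 2 - a 1)]
    · refine hlim fun n => le_trans ?_ (hdist n)
      simp only [Fin.mk_one, inv_mul_eq_div]
      linarith [sq_nonneg ((y n).1 0 / (y n).1 2 - a 0)]
    · refine hlim fun n => ?_
      simp only [Fin.reduceFinMk, inv_mul_cancel₀ (hy n).ne', ha2]
      norm_num
      positivity
  refine mem_closure_of_tendsto htend (Filter.Eventually.of_forall fun n => ?_)
  convert hmem n using 1
  refine IsLift.unique (v := ofR (((y n).1 2)⁻¹ • (y n).1)) (isLift_mk _ _) ?_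
  have h := (isLift_mk (ofR (y n).1) (ofR_ne_zero (hy n))).smul (c := (((y n).1 2)⁻¹ : ℝ))
    (by exact_mod_cast inv_ne_zero (hy n).ne')
  convert h using 1
  ext i
  simp [ofR]

theorem limitSet_eq (Γ : Subgroup PO21) [CompactSpace (Surface Γ)] :
    limitSet (Γ.map toPU) = (Set.range toSphere)ᶜ := by
  ext p
  constructor
  · rintro hp ⟨w, rfl⟩
    exact limitSet_disjoint_range Γ w hp
  · intro hp
    obtain ⟨v, hv, hn⟩ := p.2
    have hQ : cdot v v = 0 := by
      by_contra h
      exact hp ((mem_range_toSphere hv).2 h)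
    obtain ⟨c, a, hc, ha, ha2, rfl⟩ := exists_real_of_null hv.1 hn hQ
    refine mem_limitSet_of_real Γ ha ha2 ?_
    have := hv.smul (inv_ne_zero hc)
    rwa [smul_smul, inv_mul_cancel₀ hc, one_smul] at this

/-! ### The complement of the crown as a cover of the drilled unit tangent bundle -/

/-- A quotient map whose fibres are the `Δ`-orbits identifies its target with `Δ \ Ω`. -/
def quotientOfHomeo {M : Type} [TopologicalSpace M] (Δ : Subgroup PU21) (Ω : Set S3) (q : Ω → M)
    (hq : IsQuotientMap q) (h : ∀ x y : Ω, q x = q y ↔ ∃ g ∈ Δ, g • (y : S3) = x) :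
    QuotientOf Δ Ω ≃ₜ M where
  toFun := Quotient.lift q fun x y hxy => by
    obtain ⟨g, hg⟩ := hxy
    exact (h x y).2 ⟨g, g.2, hg⟩
  invFun m := toQuotientOf Δ Ω (Function.surjInv hq.surjective m)
  left_inv := by
    rintro ⟨x⟩
    obtain ⟨g, hg, e⟩ := (h _ x).1 (Function.surjInv_eq hq.surjective (q x))
    exact Quotient.sound ⟨⟨g, hg⟩, e⟩
  right_inv m := Function.surjInv_eq hq.surjective m
  continuous_toFun := hq.continuous.quotient_lift _
  continuous_invFun := by
    rw [hq.continuous_iff]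
    have e : (fun m => toQuotientOf Δ Ω (Function.surjInv hq.surjective m)) ∘ q =
        toQuotientOf Δ Ω := by
      funext x
      obtain ⟨g, hg, e⟩ := (h _ x).1 (Function.surjInv_eq hq.surjective (q x))
      exact Quotient.sound ⟨⟨g, hg⟩, e⟩
    rw [e]
    exact continuous_quotient_mk'

/-- The preimage in `U H²_ℝ` of the complement of a subset of `UΣ`. -/
def drilledPreimage (Γ : Subgroup PO21) (l : Set (UnitTangent Γ)) : Set UHR2 :=
  toUnitTangent Γ ⁻¹' lᶜ

/-- The projection onto the drilled unit tangent bundle. -/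
def drilledMap (Γ : Subgroup PO21) (l : Set (UnitTangent Γ)) (w : drilledPreimage Γ l) :
    Drilled Γ l :=
  ⟨toUnitTangent Γ w, w.2⟩

theorem toUnitTangent_eq_iff (Γ : Subgroup PO21) (w w' : UHR2) :
    toUnitTangent Γ w = toUnitTangent Γ w' ↔ ∃ g ∈ Γ, g • w' = w := by
  refine Quotient.eq.trans (MulAction.orbitRel_apply.trans ?_)
  exact ⟨fun ⟨g, h⟩ => ⟨g, g.2, h⟩, fun ⟨g, hg, h⟩ => ⟨⟨g, hg⟩, h⟩⟩

theorem toUnitTangent_smul {Γ : Subgroup PO21} {g : PO21} (hg : g ∈ Γ) (w : UHR2) :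
    toUnitTangent Γ (g • w) = toUnitTangent Γ w :=
  (toUnitTangent_eq_iff Γ _ _).2 ⟨g, hg, rfl⟩

theorem isOpenQuotientMap_toUnitTangent (Γ : Subgroup PO21) :
    IsOpenQuotientMap (toUnitTangent Γ) :=
  ⟨Quotient.mk_surjective, continuous_quotient_mk', isOpenMap_quotient_mk'_mul⟩

theorem isOpenQuotientMap_drilledMap (Γ : Subgroup PO21) (l : Set (UnitTangent Γ)) :
    IsOpenQuotientMap (drilledMap Γ l) :=
  (isOpenQuotientMap_toUnitTangent Γ).restrictPreimage lᶜ

/-- The image of the preimage of the complement of a subset of `UΣ` in the sphere. -/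
def drilledDomain (Γ : Subgroup PO21) (l : Set (UnitTangent Γ)) : Set S3 :=
  toSphere '' drilledPreimage Γ l

/-- The identification given by `toSphere`. -/
def drilledHomeo (Γ : Subgroup PO21) (l : Set (UnitTangent Γ)) :
    drilledPreimage Γ l ≃ₜ drilledDomain Γ l :=
  isEmbedding_toSphere.homeomorphImage _

theorem coe_drilledHomeo (Γ : Subgroup PO21) (l : Set (UnitTangent Γ)) (w : drilledPreimage Γ l) :
    (drilledHomeo Γ l w : S3) = toSphere w := rfl

theorem drilledMap_symm_eq_iff (Γ : Subgroup PO21) (l : Set (UnitTangent Γ))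
    (x y : drilledDomain Γ l) :
    (drilledMap Γ l ∘ (drilledHomeo Γ l).symm) x = (drilledMap Γ l ∘ (drilledHomeo Γ l).symm) y ↔
      ∃ g ∈ Γ.map toPU, g • (y : S3) = x := by
  obtain ⟨w, rfl⟩ := (drilledHomeo Γ l).surjective x
  obtain ⟨w', rfl⟩ := (drilledHomeo Γ l).surjective y
  simp only [Function.comp_apply, Homeomorph.symm_apply_apply, coe_drilledHomeo]
  refine Subtype.ext_iff.trans ((toUnitTangent_eq_iff Γ _ _).trans ?_)
  constructor
  · rintro ⟨g, hg, e⟩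
    exact ⟨toPU g, ⟨g, hg, rfl⟩, by rw [← toSphere_smul, e]⟩
  · rintro ⟨_, ⟨g, hg, rfl⟩, e⟩
    rw [← toSphere_smul] at e
    exact ⟨g, hg, toSphere_injective e⟩

/-- The quotient of the domain in the sphere by `Γ` is the drilled unit tangent bundle. -/
def drilledQuotientHomeo (Γ : Subgroup PO21) (l : Set (UnitTangent Γ)) (Δ : Subgroup PU21)
    (hΔ : Δ = Γ.map toPU) : QuotientOf Δ (drilledDomain Γ l) ≃ₜ Drilled Γ l :=
  quotientOfHomeo Δ _ (drilledMap Γ l ∘ (drilledHomeo Γ l).symm)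
    ((isOpenQuotientMap_drilledMap Γ l).isQuotientMap.comp (drilledHomeo Γ l).symm.isQuotientMap)
    (hΔ ▸ drilledMap_symm_eq_iff Γ l)

theorem drilledQuotientHomeo_apply (Γ : Subgroup PO21) (l : Set (UnitTangent Γ))
    (Δ : Subgroup PU21) (hΔ : Δ = Γ.map toPU) (w : drilledPreimage Γ l) :
    drilledQuotientHomeo Γ l Δ hΔ (toQuotientOf Δ _ (drilledHomeo Γ l w)) = drilledMap Γ l w := by
  change (drilledMap Γ l ∘ (drilledHomeo Γ l).symm) (drilledHomeo Γ l w) = _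
  simp

theorem mem_closedOrbit_iff (Γ : Subgroup PO21) (γ : PO21) (w : UHR2) :
    toUnitTangent Γ w ∈ closedOrbit Γ γ ↔ ∃ g ∈ Γ, g⁻¹ • w ∈ liftedAxis γ := by
  constructor
  · rintro ⟨w', hw', e⟩
    obtain ⟨g, hg, h⟩ := (toUnitTangent_eq_iff Γ _ _).1 e
    exact ⟨g⁻¹, Γ.inv_mem hg, by rwa [inv_inv, h]⟩
  · rintro ⟨g, hg, h⟩
    exact ⟨_, h, toUnitTangent_smul (Γ.inv_mem hg) w⟩

theorem crownComplement_eq (Γ : Subgroup PO21) [CompactSpace (Surface Γ)] (γ : PO21) :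
    crownComplement (Γ.map toPU) (toPU γ) = drilledDomain Γ (closedOrbit Γ γ) := by
  have h : ∀ w, toSphere w ∈ crown (Γ.map toPU) (toPU γ) ↔
      toUnitTangent Γ w ∈ closedOrbit Γ γ := by
    intro w
    rw [mem_closedOrbit_iff, crown, limitSet_eq]
    simp only [Set.mem_union, Set.mem_compl_iff, Set.mem_range_self, not_true, false_or,
      Set.mem_iUnion]
    constructor
    · rintro ⟨_, ⟨g, hg, rfl⟩, h⟩
      exact ⟨g, hg, mem_translate_axis.1 h⟩
    · rintro ⟨g, hg, h⟩
      exact ⟨toPU g, ⟨g, hg, rfl⟩, mem_translate_axis.2 h⟩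
  ext p
  constructor
  · intro hp
    have hr : p ∈ Set.range toSphere := by
      by_contra hr
      exact hp (Or.inl (by rwa [limitSet_eq]))
    obtain ⟨w, rfl⟩ := hr
    exact ⟨w, fun hw => hp ((h w).2 hw), rfl⟩
  · rintro ⟨w, hw, rfl⟩ hp
    exact hw ((h w).1 hp)

/-! ### Properness of the action on the unit tangent bundle -/

/-- The matrix with columns `u`, a unit normal to the geodesic through `(x, u)`, and `x`. -/
def frameMatrix (w : UHR2) : Matrix (Fin 3) (Fin 3) ℝ :=
  !![w.1.2 0, w.1.1 1 * w.1.2 2 - w.1.1 2 * w.1.2 1, w.1.1 0;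
     w.1.2 1, w.1.1 2 * w.1.2 0 - w.1.1 0 * w.1.2 2, w.1.1 1;
     w.1.2 2, w.1.1 1 * w.1.2 0 - w.1.1 0 * w.1.2 1, w.1.1 2]

/-- The inverse of `frameMatrix`. -/
def frameMatrixInv (w : UHR2) : Matrix (Fin 3) (Fin 3) ℝ :=
  !![w.1.2 0, w.1.2 1, -w.1.2 2;
     w.1.1 1 * w.1.2 2 - w.1.1 2 * w.1.2 1, w.1.1 2 * w.1.2 0 - w.1.1 0 * w.1.2 2,
      -(w.1.1 1 * w.1.2 0 - w.1.1 0 * w.1.2 1);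
     -w.1.1 0, -w.1.1 1, w.1.1 2]

/-- Lagrange's identity for the Lorentzian cross product: the norm is `(x·u)² - (x·x)(u·u) = 1`. -/
theorem mink_normal (w : UHR2) :
    (w.1.1 1 * w.1.2 2 - w.1.1 2 * w.1.2 1) ^ 2 + (w.1.1 2 * w.1.2 0 - w.1.1 0 * w.1.2 2) ^ 2 -
      (w.1.1 1 * w.1.2 0 - w.1.1 0 * w.1.2 1) ^ 2 = 1 := by
  have h1 := w.2.1.1
  have h3 := w.2.2.1
  have h4 := w.2.2.2
  simp only [mink] at h1 h3 h4
  linear_combination (-(w.1.2 0 * w.1.2 0 + w.1.2 1 * w.1.2 1 - w.1.2 2 * w.1.2 2)) * h1 + h4 +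
    (w.1.1 0 * w.1.2 0 + w.1.1 1 * w.1.2 1 - w.1.1 2 * w.1.2 2) * h3

theorem frameMatrixInv_mul (w : UHR2) : frameMatrixInv w * frameMatrix w = 1 := by
  have h1 := w.2.1.1
  have h3 := w.2.2.1
  have h4 := w.2.2.2
  have h5 := mink_normal w
  simp only [mink] at h1 h3 h4
  ext i j
  fin_cases i <;> fin_cases j <;>
    simp [frameMatrixInv, frameMatrix, Matrix.mul_apply, Fin.sum_univ_three] <;> linarith

/-- The isometry that takes the standard unit tangent vector to `w`. -/
def frame (w : UHR2) : PO21 :=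
  ⟨⟨frameMatrix w, frameMatrixInv w, mul_eq_one_comm.1 (frameMatrixInv_mul w),
    frameMatrixInv_mul w⟩, by
    have key : ∀ (a : Fin 3 → ℝ) (i : Fin 3), ((⟨frameMatrix w, frameMatrixInv w,
        mul_eq_one_comm.1 (frameMatrixInv_mul w), frameMatrixInv_mul w⟩ : GL (Fin 3) ℝ) • a) i =
        frameMatrix w i 0 * a 0 + frameMatrix w i 1 * a 1 + frameMatrix w i 2 * a 2 := by
      intro a i
      simp [Units.smul_def, Matrix.smul_eq_mulVec, Matrix.mulVec, dotProduct, Fin.sum_univ_three]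
    have h1 := w.2.1.1
    have h2 := w.2.1.2
    have h3 := w.2.2.1
    have h4 := w.2.2.2
    have h5 := mink_normal w
    simp only [mink] at h1 h3 h4
    constructor
    · intro a b
      simp only [mink, key]
      simp only [frameMatrix, Matrix.cons_val, Matrix.of_apply]
      linear_combination (a 0 * b 0) * h4 + (a 1 * b 1) * h5 + (a 2 * b 2) * h1 +
        (a 0 * b 2 + a 2 * b 0) * h3
    · intro y hy hy2
      rw [key]
      simp only [frameMatrix, Matrix.cons_val, Matrix.of_apply]
      simp only [mink] at hy
      generalize hn : w.1.1 1 * w.1.2 0 - w.1.1 0 * w.1.2 1 = n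
      have h6 : w.1.2 2 ^ 2 + n ^ 2 = w.1.1 2 ^ 2 - 1 := by
        rw [← hn]
        linear_combination (w.1.2 0 * w.1.2 0 + w.1.2 1 * w.1.2 1) * h1 +
          (w.1.1 2 ^ 2 - 1) * h4 - (w.1.1 0 * w.1.2 0 + w.1.1 1 * w.1.2 1 + w.1.1 2 * w.1.2 2) * h3
      -- Cauchy–Schwarz: the left side is at most `(x₂² - 1)(y₂² - 1)`, where `x₂ = w.1.1 2` and `y₂
      -- = y 2`.
      have h7 : (w.1.2 2 * y 0 + n * y 1) ^ 2 < (w.1.1 2 * y 2) ^ 2 := by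
        have e : (w.1.1 2 * y 2) ^ 2 = (w.1.2 2 ^ 2 + n ^ 2 + 1) * (y 0 ^ 2 + y 1 ^ 2 + 1) := by
          rw [h6]
          linear_combination (-(w.1.1 2 ^ 2)) * hy
        rw [e]
        nlinarith [sq_nonneg (w.1.2 2 * y 1 - n * y 0), sq_nonneg (w.1.2 2), sq_nonneg n,
          sq_nonneg (y 0), sq_nonneg (y 1)]
      have h8 := abs_lt_of_sq_lt_sq h7 (mul_pos h2 hy2).le
      linarith [(abs_lt.1 h8).1]⟩

theorem continuous_frame : Continuous frame := by
  have hx : ∀ i, Continuous fun w : UHR2 => w.1.1 i := fun i =>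
    (continuous_apply i).comp (continuous_fst.comp continuous_subtype_val)
  have hu : ∀ i, Continuous fun w : UHR2 => w.1.2 i := fun i =>
    (continuous_apply i).comp (continuous_snd.comp continuous_subtype_val)
  refine Continuous.subtype_mk (Units.continuous_iff.2 ⟨?_, ?_⟩) _
  · change Continuous frameMatrix
    refine continuous_matrix fun i j => ?_
    fin_cases i <;> fin_cases j <;> simp [frameMatrix] <;> fun_prop
  · change Continuous frameMatrixInv
    refine continuous_matrix fun i j => ?_
    fin_cases i <;> fin_cases j <;> simp [frameMatrixInv] <;> fun_prop

/-- The standard unit tangent vector. -/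
def baseVector : UHR2 := ⟨(![0, 0, 1], ![1, 0, 0]), by simp [mink]⟩

theorem frame_smul_baseVector (w : UHR2) : frame w • baseVector = w := by
  apply Subtype.ext
  apply Prod.ext
  · change (frame w : GL (Fin 3) ℝ) • (![0, 0, 1] : Fin 3 → ℝ) = w.1.1
    ext i
    simp only [frame, Units.smul_def, Matrix.smul_eq_mulVec, Matrix.mulVec, dotProduct,
      Fin.sum_univ_three]
    fin_cases i <;> simp [frameMatrix]
  · change (frame w : GL (Fin 3) ℝ) • (![1, 0, 0] : Fin 3 → ℝ) = w.1.2
    ext i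
    simp only [frame, Units.smul_def, Matrix.smul_eq_mulVec, Matrix.mulVec, dotProduct,
      Fin.sum_univ_three]
    fin_cases i <;> simp [frameMatrix]

/-- Such an isometry fixes `e₀` and `e₂`, so it sends `e₁` to `±e₁`: it is the identity or the
reflection in the geodesic. -/
theorem finite_stabilizer : {A : PO21 | A • baseVector = baseVector}.Finite := by
  have h0 : ∀ A : PO21, A • baseVector = baseVector →
      (A : GL (Fin 3) ℝ) • (![0, 0, 1] : Fin 3 → ℝ) = ![0, 0, 1] ∧
      (A : GL (Fin 3) ℝ) • (![1, 0, 0] : Fin 3 → ℝ) = ![1, 0, 0] := fun A hA =>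
    ⟨congrArg (fun w : UHR2 => w.1.1) hA, congrArg (fun w : UHR2 => w.1.2) hA⟩
  have h1 : ∀ A : PO21, A • baseVector = baseVector → ∃ b : ℝ, (b = 1 ∨ b = -1) ∧
      (A : GL (Fin 3) ℝ) • (![0, 1, 0] : Fin 3 → ℝ) = ![0, b, 0] := by
    intro A hA
    obtain ⟨e2, e0⟩ := h0 A hA
    have a0 := A.2.1 ![0, 1, 0] ![1, 0, 0]
    have a2 := A.2.1 ![0, 1, 0] ![0, 0, 1]
    have a1 := A.2.1 ![0, 1, 0] ![0, 1, 0]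
    rw [e0] at a0
    rw [e2] at a2
    generalize (A : GL (Fin 3) ℝ) • (![0, 1, 0] : Fin 3 → ℝ) = v at a0 a1 a2
    simp [mink] at a0 a1 a2
    rw [a0, a2] at a1
    refine ⟨v 1, mul_self_eq_one_iff.1 (by linarith), ?_⟩
    ext i
    fin_cases i <;> simp [a0, a2]
  choose! b hb hb' using h1
  refine Set.Finite.of_injOn (f := b) (t := {1, -1}) (fun A hA => hb A hA) ?_ (by simp)
  intro A hA B hB hAB
  apply Subtype.ext
  apply Units.ext
  apply Matrix.ext_of_mulVec_single
  intro i
  change (A : GL (Fin 3) ℝ) • (Pi.single i 1 : Fin 3 → ℝ) = (B : GL (Fin 3) ℝ) • Pi.single i 1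
  have hs0 : (Pi.single 0 1 : Fin 3 → ℝ) = ![1, 0, 0] := by ext j; fin_cases j <;> simp
  have hs1 : (Pi.single 1 1 : Fin 3 → ℝ) = ![0, 1, 0] := by ext j; fin_cases j <;> simp
  have hs2 : (Pi.single 2 1 : Fin 3 → ℝ) = ![0, 0, 1] := by ext j; fin_cases j <;> simp
  fin_cases i
  · change _ • (Pi.single 0 1 : Fin 3 → ℝ) = _ • (Pi.single 0 1 : Fin 3 → ℝ)
    rw [hs0, (h0 A hA).2, (h0 B hB).2]
  · change _ • (Pi.single 1 1 : Fin 3 → ℝ) = _ • (Pi.single 1 1 : Fin 3 → ℝ)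
    rw [hs1, hb' A hA, hb' B hB, hAB]
  · change _ • (Pi.single 2 1 : Fin 3 → ℝ) = _ • (Pi.single 2 1 : Fin 3 → ℝ)
    rw [hs2, (h0 A hA).1, (h0 B hB).1]

/-- Properness of the action: `A` is `frame (A • w)` times a stabilizer element times `(frame w)⁻¹`,
and each factor ranges over a compact set. -/
theorem exists_isCompact_of_meet {K L : Set UHR2} (hK : IsCompact K) (hL : IsCompact L) :
    ∃ C : Set PO21, IsCompact C ∧ ∀ A : PO21, ∀ w ∈ K, A • w ∈ L → A ∈ C := by
  refine ⟨(fun z : UHR2 × PO21 × UHR2 => frame z.1 * z.2.1 * (frame z.2.2)⁻¹) ''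
    (L ×ˢ ({A : PO21 | A • baseVector = baseVector} ×ˢ K)),
    (hL.prod (finite_stabilizer.isCompact.prod hK)).image ?_, fun A w hw hA => ?_⟩
  · have := continuous_frame
    fun_prop
  · refine ⟨(A • w, (frame (A • w))⁻¹ * A * frame w, w), ⟨hA, ?_, hw⟩, ?_⟩
    · change ((frame (A • w))⁻¹ * A * frame w) • baseVector = baseVector
      rw [mul_smul, frame_smul_baseVector, mul_smul, inv_smul_eq_iff, frame_smul_baseVector]
    · simp [mul_assoc]

instance properlyDiscontinuousSMul_UHR2 (Γ : Subgroup PO21) [DiscreteTopology Γ] :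
    ProperlyDiscontinuousSMul Γ UHR2 where
  finite_disjoint_inter_image := by
    intro K L hK hL
    obtain ⟨C, hC, h⟩ := exists_isCompact_of_meet hK hL
    have hcl : IsClosed (Γ : Set PO21) := Subgroup.isClosed_of_discrete
    have hfin : ((Subtype.val : Γ → PO21) ⁻¹' C).Finite :=
      (hcl.isClosedEmbedding_subtypeVal.isCompact_preimage hC).finite_of_discrete
    refine hfin.subset ?_
    rintro g ⟨_, ⟨w, hw, rfl⟩, hg⟩
    exact h g w hw hg

instance : LocallyCompactSpace UHR2 := by
  have h : IsLocallyClosed {w : (Fin 3 → ℝ) × (Fin 3 → ℝ) |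
      (mink w.1 w.1 = -1 ∧ 0 < w.1 2) ∧ mink w.1 w.2 = 0 ∧ mink w.2 w.2 = 1} := by
    have hc : IsClosed {w : (Fin 3 → ℝ) × (Fin 3 → ℝ) |
        mink w.1 w.1 = -1 ∧ mink w.1 w.2 = 0 ∧ mink w.2 w.2 = 1} := by
      unfold mink
      exact (isClosed_eq (by fun_prop) continuous_const).inter
        ((isClosed_eq (by fun_prop) continuous_const).inter
          (isClosed_eq (by fun_prop) continuous_const))
    have ho : IsOpen {w : (Fin 3 → ℝ) × (Fin 3 → ℝ) | 0 < w.1 2} :=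
      isOpen_lt continuous_const (by fun_prop)
    convert ho.isLocallyClosed.inter hc.isLocallyClosed using 1
    ext w
    simp only [Set.mem_ofPred_eq, Set.mem_inter_iff]
    tauto
  exact h.locallyCompactSpace

theorem countable_of_discrete (Γ : Subgroup PO21) [DiscreteTopology Γ] : Countable Γ := by
  have : SecondCountableTopology (Matrix (Fin 3) (Fin 3) ℝ) :=
    inferInstanceAs (SecondCountableTopology (Fin 3 → Fin 3 → ℝ))
  have : SecondCountableTopology (Matrix (Fin 3) (Fin 3) ℝ)ᵐᵒᵖ :=
    MulOpposite.opHomeomorph.symm.isEmbedding.secondCountableTopology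
  have : SecondCountableTopology (GL (Fin 3) ℝ) :=
    Units.isEmbedding_embedProduct.secondCountableTopology
  exact countable_of_Lindelof_of_discrete

/-! ### The closed orbit -/

theorem continuous_geodesicFlow : Continuous fun z : ℝ × UHR2 => geodesicFlow z.1 z.2 := by
  have hx : Continuous fun z : ℝ × UHR2 => z.2.1.1 :=
    continuous_fst.comp (continuous_subtype_val.comp continuous_snd)
  have hu : Continuous fun z : ℝ × UHR2 => z.2.1.2 :=
    continuous_snd.comp (continuous_subtype_val.comp continuous_snd)
  have hc : Continuous fun z : ℝ × UHR2 => Real.cosh z.1 := Real.continuous_cosh.comp continuous_fst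
  have hs : Continuous fun z : ℝ × UHR2 => Real.sinh z.1 := Real.continuous_sinh.comp continuous_fst
  exact (((hc.smul hx).add (hs.smul hu)).prodMk ((hs.smul hx).add (hc.smul hu))).subtype_mk _

theorem closedOrbit_eq_range {Γ : Subgroup PO21} {γ : PO21} {w : UHR2} (hw : w ∈ liftedAxis γ) :
    closedOrbit Γ γ = Set.range fun t : ℝ => toUnitTangent Γ (geodesicFlow t w) := by
  rw [closedOrbit, liftedAxis_eq_range hw, ← Set.range_comp]
  rfl

/-- The orbit is periodic, hence the image of a compact interval, and the quotient by a properly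
discontinuous action is Hausdorff. -/
theorem isClosed_closedOrbit {Γ : Subgroup PO21} [DiscreteTopology Γ] {γ : PO21} (hγ : γ ∈ Γ)
    {w : UHR2} (hw : w ∈ liftedAxis γ) : IsClosed (closedOrbit Γ γ) := by
  have : T2Space (UnitTangent Γ) := t2Space_of_properlyDiscontinuousSMul_of_t2Space
  rw [closedOrbit_eq_range hw]
  obtain ⟨l, hl, e⟩ := hw
  have hper : Function.Periodic (fun t : ℝ => toUnitTangent Γ (geodesicFlow t w)) l := by
    intro t
    dsimp only
    rw [geodesicFlow_add, ← e, ← smul_geodesicFlow, toUnitTangent_smul hγ]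
  have hcont : Continuous fun t : ℝ => toUnitTangent Γ (geodesicFlow t w) :=
    (isOpenQuotientMap_toUnitTangent Γ).continuous.comp
      (continuous_geodesicFlow.comp (continuous_id.prodMk continuous_const))
  rw [← hper.image_Icc hl 0]
  exact (isCompact_Icc.image hcont).isClosed

theorem isOpen_drilledDomain {Γ : Subgroup PO21} {l : Set (UnitTangent Γ)} (hl : IsClosed l) :
    IsOpen (drilledDomain Γ l) :=
  isOpenEmbedding_toSphere.isOpenMap _
    (hl.isOpen_compl.preimage (isOpenQuotientMap_toUnitTangent Γ).continuous)

/-! ### Connectedness of the complement of countably many geodesics -/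

/-- A section of the space of oriented geodesics, over its universal cover: the point of the
geodesic that is closest to the origin. -/
def closestVector (p : ℝ × ℝ) : UHR2 :=
  ⟨(![Real.sinh p.2 * Real.cos p.1, Real.sinh p.2 * Real.sin p.1, Real.cosh p.2],
    ![-Real.sin p.1, Real.cos p.1, 0]), by
    have h1 := Real.sin_sq_add_cos_sq p.1
    have h2 := Real.cosh_sq p.2
    refine ⟨⟨?_, Real.cosh_pos _⟩, ?_, ?_⟩
    · simp only [mink, Matrix.cons_val]
      linear_combination Real.sinh p.2 ^ 2 * h1 - h2
    · simp only [mink, Matrix.cons_val]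
      ring
    · simp only [mink, Matrix.cons_val]
      linear_combination h1⟩

theorem continuous_closestVector : Continuous closestVector := by
  refine Continuous.subtype_mk (Continuous.prodMk (continuous_pi fun i => ?_)
    (continuous_pi fun i => ?_)) _
  · fin_cases i <;> simp <;> fun_prop
  · fin_cases i <;> simp <;> fun_prop

theorem exists_closestVector_eq {w : UHR2} (h : w.1.2 2 = 0) : ∃ p, closestVector p = w := by
  obtain ⟨⟨x, u⟩, ⟨h1, h2⟩, h3, h4⟩ := w
  change mink x x = -1 at h1
  change 0 < x 2 at h2
  change mink x u = 0 at h3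
  change mink u u = 1 at h4
  change u 2 = 0 at h
  simp only [mink, h] at h1 h3 h4
  -- The angle is chosen so that `(-sin, cos)` equals `(u 0, u 1)`; the second parameter is the
  -- signed distance from the origin to the geodesic.
  let z : ℂ := ⟨u 1, -u 0⟩
  have hz : ‖z‖ = 1 := by
    rw [← pow_eq_one_iff_of_nonneg (norm_nonneg z) two_ne_zero, ← Complex.normSq_eq_norm_sq,
      Complex.normSq_apply]
    linarith
  have hc : Real.cos z.arg = u 1 := by
    rw [Complex.cos_arg (by intro h0; simp [h0] at hz), hz, div_one]
  have hs : Real.sin z.arg = -u 0 := by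
    rw [Complex.sin_arg, hz, div_one]
  have hsinh : Real.sinh (Real.arsinh (x 0 * u 1 - x 1 * u 0)) = x 0 * u 1 - x 1 * u 0 :=
    Real.sinh_arsinh _
  refine ⟨(z.arg, Real.arsinh (x 0 * u 1 - x 1 * u 0)), ?_⟩
  have hcosh : Real.cosh (Real.arsinh (x 0 * u 1 - x 1 * u 0)) = x 2 := by
    have h5 := Real.cosh_sq (Real.arsinh (x 0 * u 1 - x 1 * u 0))
    rw [hsinh] at h5
    refine (pow_left_inj₀ (Real.cosh_pos _).le h2.le two_ne_zero).1 ?_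
    rw [h5]
    linear_combination (u 0 * u 0 + u 1 * u 1) * h1 + (x 2 ^ 2 - 1) * h4 -
      (x 0 * u 0 + x 1 * u 1) * h3
  apply Subtype.ext
  apply Prod.ext
  · ext i
    fin_cases i
    · simp [closestVector, hsinh, hc]
      linear_combination x 0 * h4 - u 0 * h3
    · simp [closestVector, hsinh, hs]
      linear_combination x 1 * h4 - u 1 * h3
    · simp [closestVector, hcosh]
  · ext i
    fin_cases i
    · simp [closestVector, hs]
    · simp [closestVector, hc]
    · simp [closestVector, h]

theorem exists_geodesicFlow_closestVector_eq (w : UHR2) :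
    ∃ t p, geodesicFlow t (closestVector p) = w := by
  have h := abs_lt.1 (abs_snd_lt w)
  have h2 := w.2.1.2
  obtain ⟨t, ht⟩ : ∃ t, (geodesicFlow t w).1.2 2 = 0 := by
    have hk : 0 < (w.1.1 2 - w.1.2 2) / (w.1.1 2 + w.1.2 2) :=
      div_pos (by linarith) (by linarith)
    -- Solution of `sinh t * x 2 + cosh t * u 2 = 0`, that is, `exp (2t) = (x 2 - u 2) / (x 2 + u
    -- 2)`.
    refine ⟨Real.log ((w.1.1 2 - w.1.2 2) / (w.1.1 2 + w.1.2 2)) / 2, ?_⟩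
    set t := Real.log ((w.1.1 2 - w.1.2 2) / (w.1.1 2 + w.1.2 2)) / 2 with ht
    have e : Real.exp t * Real.exp t = (w.1.1 2 - w.1.2 2) / (w.1.1 2 + w.1.2 2) := by
      rw [← Real.exp_add, ht, add_halves, Real.exp_log hk]
    have e' : Real.exp t * Real.exp (-t) = 1 := by
      rw [← Real.exp_add, add_neg_cancel, Real.exp_zero]
    rw [eq_div_iff (by linarith)] at e
    change Real.sinh t * w.1.1 2 + Real.cosh t * w.1.2 2 = 0
    rw [Real.sinh_eq, Real.cosh_eq]
    have h0 : Real.exp t * ((Real.exp t - Real.exp (-t)) / 2 * w.1.1 2 +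
        (Real.exp t + Real.exp (-t)) / 2 * w.1.2 2) = 0 := by
      linear_combination e / 2 + (w.1.2 2 - w.1.1 2) / 2 * e'
    exact (mul_eq_zero.1 h0).resolve_left (Real.exp_ne_zero t)
  obtain ⟨p, hp⟩ := exists_closestVector_eq ht
  exact ⟨-t, p, by rw [hp, ← geodesicFlow_add, neg_add_cancel, geodesicFlow_zero]⟩

theorem countable_fiber_closestVector (p : ℝ × ℝ) :
    {q | closestVector q = closestVector p}.Countable := by
  refine (Set.countable_range fun k : ℤ => (p.1 + 2 * Real.pi * k, p.2)).mono fun q hq => ?_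
  have e1 := congrArg (fun w : UHR2 => w.1.2 0) hq
  have e2 := congrArg (fun w : UHR2 => w.1.2 1) hq
  have e3 := congrArg (fun w : UHR2 => w.1.1 0) hq
  have e4 := congrArg (fun w : UHR2 => w.1.1 1) hq
  simp only [closestVector, Matrix.cons_val, neg_inj] at e1 e2 e3 e4
  rw [e1] at e4
  rw [e2] at e3
  have h1 := Real.sin_sq_add_cos_sq p.1
  have e5 : Real.sinh q.2 = Real.sinh p.2 := by
    linear_combination Real.cos p.1 * e3 + Real.sin p.1 * e4 -
      (Real.sinh q.2 - Real.sinh p.2) * h1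
  obtain ⟨k, hk⟩ := Real.Angle.angle_eq_iff_two_pi_dvd_sub.1 (Real.Angle.cos_sin_inj e2 e1)
  exact ⟨k, Prod.ext (by simp only; linarith) (Real.sinh_injective e5).symm⟩

/-- Along a flow line the height is least at one vector only: starting from a closest vector, the
last coordinate of `u` is `sinh` of the elapsed time times a positive number. The remaining
parameters differ by multiples of `2π` in the angle. -/
theorem countable_closestVector_mem_orbit (w : UHR2) :
    {p | ∃ t, closestVector p = geodesicFlow t w}.Countable := by
  rcases Set.eq_empty_or_nonempty {p | ∃ t, closestVector p = geodesicFlow t w} with h | ⟨p, t, hp⟩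
  · rw [h]
    exact Set.countable_empty
  · refine (countable_fiber_closestVector p).mono ?_
    rintro q ⟨s, hq⟩
    have e : closestVector q = geodesicFlow (s - t) (closestVector p) := by
      rw [hq, hp, ← geodesicFlow_add, sub_add_cancel]
    have h2 := congrArg (fun w : UHR2 => w.1.2 2) e
    have h3 : (0 : ℝ) = Real.sinh (s - t) * Real.cosh p.2 + Real.cosh (s - t) * 0 := h2
    rw [mul_zero, add_zero, eq_comm, mul_eq_zero, Real.sinh_eq_zero] at h3
    rw [Set.mem_ofPred_eq, e, h3.resolve_right (Real.cosh_pos _).ne', geodesicFlow_zero]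

/-- The removed set is invariant under the flow and consists of countably many geodesics. Its
complement is thus the continuous image of `ℝ` times the plane minus a countable set, which is path
connected. -/
theorem isPathConnected_drilledPreimage (Γ : Subgroup PO21) [DiscreteTopology Γ] (w : UHR2) :
    IsPathConnected (drilledPreimage Γ
      (Set.range fun t : ℝ => toUnitTangent Γ (geodesicFlow t w))) := by
  set l := Set.range fun t : ℝ => toUnitTangent Γ (geodesicFlow t w) with hl
  have hmem : ∀ v, toUnitTangent Γ v ∈ l ↔ ∃ g : Γ, ∃ t, v = geodesicFlow t ((g : PO21) • w) := by
    intro v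
    constructor
    · rintro ⟨t, e⟩
      obtain ⟨g, hg, h⟩ := (toUnitTangent_eq_iff Γ _ _).1 e.symm
      exact ⟨⟨g, hg⟩, t, by rw [← h, smul_geodesicFlow]⟩
    · rintro ⟨g, t, rfl⟩
      exact ⟨t, by rw [← smul_geodesicFlow, toUnitTangent_smul g.2]⟩
  have hflow : ∀ t v, toUnitTangent Γ (geodesicFlow t v) ∈ l ↔ toUnitTangent Γ v ∈ l := by
    intro t v
    rw [hmem, hmem]
    refine exists_congr fun g => ⟨?_, ?_⟩
    · rintro ⟨s, e⟩
      refine ⟨-t + s, ?_⟩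
      rw [geodesicFlow_add, ← e, ← geodesicFlow_add, neg_add_cancel, geodesicFlow_zero]
    · rintro ⟨s, rfl⟩
      exact ⟨t + s, (geodesicFlow_add _ _ _).symm⟩
  have hcount : {p | toUnitTangent Γ (closestVector p) ∈ l}.Countable := by
    have := countable_of_discrete Γ
    have e : {p | toUnitTangent Γ (closestVector p) ∈ l} =
        ⋃ g : Γ, {p | ∃ t, closestVector p = geodesicFlow t ((g : PO21) • w)} := by
      ext p
      simp only [Set.mem_iUnion, Set.mem_ofPred_eq, hmem]
    rw [e]
    exact Set.countable_iUnion fun g => countable_closestVector_mem_orbit _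
  have hpc := hcount.isPathConnected_compl_of_one_lt_rank (by
    rw [rank_prod', Module.rank_self, one_add_one_eq_two]
    exact Cardinal.one_lt_two)
  have hF : Continuous fun z : ℝ × (ℝ × ℝ) => geodesicFlow z.1 (closestVector z.2) :=
    continuous_geodesicFlow.comp
      (continuous_fst.prodMk (continuous_closestVector.comp continuous_snd))
  convert (isPathConnected_univ.prod hpc).image hF using 1
  ext v
  constructor
  · intro hv
    obtain ⟨t, p, rfl⟩ := exists_geodesicFlow_closestVector_eq v
    exact ⟨(t, p), ⟨trivial, fun hp => hv ((hflow _ _).2 hp)⟩, rfl⟩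
  · rintro ⟨⟨t, p⟩, ⟨-, hp⟩, rfl⟩ hv
    exact hp ((hflow _ _).1 hv)

/-! ### The uniformization -/

instance (Γ : Subgroup PO21) (l : Set (UnitTangent Γ)) : MulAction Γ (drilledPreimage Γ l) where
  smul g w := ⟨(g : PO21) • (w : UHR2), by
    have h := toUnitTangent_smul g.2 (w : UHR2)
    exact fun hw => w.2 (h ▸ hw)⟩
  one_smul w := Subtype.ext (one_smul PO21 (w : UHR2))
  mul_smul g h w := Subtype.ext (mul_smul (g : PO21) (h : PO21) (w : UHR2))

theorem coe_smul_drilledPreimage {Γ : Subgroup PO21} {l : Set (UnitTangent Γ)} (g : Γ)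
    (w : drilledPreimage Γ l) : ((g • w : drilledPreimage Γ l) : UHR2) = (g : PO21) • (w : UHR2) :=
  rfl

/-- Proper discontinuity gives a neighbourhood that meets only its translates by the stabilizer of
`w`. An element fixing `w` fixes its base point in the plane, so freeness makes the stabilizer
trivial. -/
theorem isQuotientCoveringMap_drilledMap {Γ : Subgroup PO21} [DiscreteTopology Γ]
    (hfree : ∀ g ∈ Γ, g ≠ 1 → ∀ x : HR2, g • x ≠ x) (l : Set (UnitTangent Γ)) :
    IsQuotientCoveringMap (drilledMap Γ l) Γ where
  toIsQuotientMap := (isOpenQuotientMap_drilledMap Γ l).isQuotientMap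
  continuous_const_smul g :=
    ((continuous_const_smul (g : PO21)).comp continuous_subtype_val).subtype_mk _
  apply_eq_iff_mem_orbit := by
    intro w w'
    refine Subtype.ext_iff.trans ((toUnitTangent_eq_iff Γ _ _).trans ?_)
    constructor
    · rintro ⟨g, hg, e⟩
      exact ⟨⟨g, hg⟩, Subtype.ext e⟩
    · rintro ⟨g, e⟩
      exact ⟨g, g.2, congrArg Subtype.val e⟩
  disjoint := by
    intro w
    obtain ⟨U, hU, h⟩ := ProperlyDiscontinuousSMul.exists_nhds_image_smul_eq_self Γ (w : UHR2)
    refine ⟨Subtype.val ⁻¹' U, continuous_subtype_val.continuousAt hU, ?_⟩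
    rintro g ⟨_, ⟨v, hv, rfl⟩, hg⟩
    have hgw : (g : PO21) • (w : UHR2) = w := h g ⟨_, ⟨v.1, hv, rfl⟩, hg⟩
    by_contra hne
    refine hfree g g.2 (fun h1 => hne (Subtype.ext h1)) ⟨w.1.1.1, w.1.2.1⟩ (Subtype.ext ?_)
    exact congrArg (fun z : UHR2 => z.1.1) hgw

theorem finite_translate_meet (Γ : Subgroup PO21) [DiscreteTopology Γ]
    (l : Set (UnitTangent Γ)) {K : Set S3} (hK : K ⊆ drilledDomain Γ l) (hc : IsCompact K) :
    {g : PU21 | g ∈ Γ.map toPU ∧ (translate g K ∩ K).Nonempty}.Finite := by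
  have hr : K ⊆ Set.range toSphere := hK.trans (Set.image_subset_range _ _)
  have hL : IsCompact (toSphere ⁻¹' K) := isEmbedding_toSphere.isInducing.isCompact_preimage' hc hr
  have hfin : {g : Γ | ((fun w => g • w) '' (toSphere ⁻¹' K) ∩ toSphere ⁻¹' K).Nonempty}.Finite :=
    ProperlyDiscontinuousSMul.finite_disjoint_inter_image hL hL
  refine (hfin.image fun g : Γ => toPU (g : PO21)).subset ?_
  rintro _ ⟨⟨g, hg, rfl⟩, p, ⟨q, hq, e⟩, hp⟩
  obtain ⟨w, rfl⟩ := hr hq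
  dsimp only at e
  rw [← toSphere_smul] at e
  subst e
  exact ⟨⟨g, hg⟩, ⟨g • w, ⟨w, hq, rfl⟩, hp⟩, rfl⟩

/-- The inverse of the monodromy of the covering of the drilled unit tangent bundle. -/
def deckHolonomy {Γ : Subgroup PO21} {l : Set (UnitTangent Γ)}
    (hp : IsQuotientCoveringMap (drilledMap Γ l) Γ) {m : Drilled Γ l}
    (e : drilledMap Γ l ⁻¹' {m}) : FundamentalGroup (Drilled Γ l) m →* Γ :=
  (MulEquiv.inv' Γ).symm.toMonoidHom.comp (hp.fundamentalGroupToMulOpposite e)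

theorem deckHolonomy_eq {Γ : Subgroup PO21} {l : Set (UnitTangent Γ)}
    (hp : IsQuotientCoveringMap (drilledMap Γ l) Γ) {m : Drilled Γ l}
    (e : drilledMap Γ l ⁻¹' {m}) (c : FundamentalGroup (Drilled Γ l) m) :
    deckHolonomy hp e c = (hp.fundamentalGroupToMulOpposite e c).unop⁻¹ := rfl

/-- A path in the cover from the base point to any of its translates projects to a loop; path
connectedness supplies such a path for every element of `Γ`. -/
theorem deckHolonomy_surjective {Γ : Subgroup PO21} {l : Set (UnitTangent Γ)}
    (hp : IsQuotientCoveringMap (drilledMap Γ l) Γ) {m : Drilled Γ l}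
    (e : drilledMap Γ l ⁻¹' {m}) (hpc : IsPathConnected (drilledPreimage Γ l)) :
    Function.Surjective (deckHolonomy hp e) := by
  have := isPathConnected_iff_pathConnectedSpace.1 hpc
  exact (MulEquiv.inv' Γ).symm.surjective.comp (hp.fundamentalGroupToMulOpposite_surjective e)

/-- The loop `c` lifts to a path from the translate of the base point by the holonomy of `c` to
the base point. -/
theorem exists_lift_deckHolonomy {Γ : Subgroup PO21} {l : Set (UnitTangent Γ)}
    (hp : IsQuotientCoveringMap (drilledMap Γ l) Γ) {m : Drilled Γ l}
    (e : drilledMap Γ l ⁻¹' {m}) (c : Path m m) :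
    ∃ α : Path (deckHolonomy hp e
        (FundamentalGroup.fromPath (Path.Homotopic.Quotient.mk c)) • e.1) e.1,
      ∀ t, drilledMap Γ l (α t) = c t := by
  have hc0 : c.toContinuousMap 0 = drilledMap Γ l e.1 := c.source.trans e.2.symm
  have h1 := hp.unop_fundamentalGroupToMulOpposite_smul (e := e)
    (γ := FundamentalGroup.fromPath (Path.Homotopic.Quotient.mk c))
  rw [deckHolonomy_eq]
  generalize (hp.fundamentalGroupToMulOpposite e
    (FundamentalGroup.fromPath (Path.Homotopic.Quotient.mk c))).unop = g at h1
  have h2 : g • e.1 = hp.isCoveringMap.liftPath c.toContinuousMap e.1 hc0 1 := h1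
  have := hp.toContinuousConstSMul
  -- The standard lift runs from `e` to `g • e`. Its translate by `g⁻¹` runs from `g⁻¹ • e` to `e`,
  -- the direction required of the holonomy.
  refine ⟨⟨⟨fun t => g⁻¹ • hp.isCoveringMap.liftPath c.toContinuousMap e.1 hc0 t,
    (continuous_const_smul g⁻¹).comp (ContinuousMap.continuous _)⟩, ?_, ?_⟩, fun t => ?_⟩
  · simp [IsCoveringMap.liftPath_zero]
  · simp [← h2]
  · exact (hp.map_smul _).trans (congrFun (hp.isCoveringMap.liftPath_lifts _ e.1 hc0) t)

theorem exists_uniformization {Γ : Subgroup PO21} {l : Set (UnitTangent Γ)} [DiscreteTopology Γ]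
    (hfree : ∀ g ∈ Γ, g ≠ 1 → ∀ x : HR2, g • x ≠ x) (hl : IsClosed l)
    (hpc : IsPathConnected (drilledPreimage Γ l)) (m : Drilled Γ l) :
    ∃ U : CRUniformization (Drilled Γ l) m,
      U.Ω = drilledDomain Γ l ∧ U.ρ.range = Γ.map toPU := by
  have hp := isQuotientCoveringMap_drilledMap hfree l
  obtain ⟨e, he⟩ := hp.surjective m
  let e' : drilledMap Γ l ⁻¹' {m} := ⟨e, he⟩
  let ρ : FundamentalGroup (Drilled Γ l) m →* PU21 :=
    (toPU.comp Γ.subtype).comp (deckHolonomy hp e')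
  have hρ : ρ.range = Γ.map toPU := by
    rw [MonoidHom.range_comp, MonoidHom.range_eq_top.2 (deckHolonomy_surjective hp e' hpc),
      ← MonoidHom.range_eq_map, MonoidHom.range_comp, Subgroup.range_subtype]
  refine ⟨{
    ρ := ρ
    Ω := drilledDomain Γ l
    isOpen := isOpen_drilledDomain hl
    smul_mem := ?_
    properlyDiscontinuous := ?_
    homeo := drilledQuotientHomeo Γ l ρ.range hρ
    base := drilledHomeo Γ l e
    homeo_base := by rw [drilledQuotientHomeo_apply, he]
    holonomy := ?_ }, rfl, hρ⟩
  · rw [hρ]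
    rintro _ ⟨g, hg, rfl⟩ _ ⟨w, hw, rfl⟩
    exact ⟨g • w, ((⟨g, hg⟩ : Γ) • (⟨w, hw⟩ : drilledPreimage Γ l)).2, toSphere_smul g w⟩
  · rw [hρ]
    exact fun K hK hc => finite_translate_meet Γ l hK hc
  · intro c
    obtain ⟨α, hα⟩ := exists_lift_deckHolonomy hp e' c
    refine ⟨_, α.map (drilledHomeo Γ l).continuous, fun t => ?_, ?_⟩
    · exact (drilledQuotientHomeo_apply Γ l _ hρ (α t)).trans (hα t)
    · rw [coe_drilledHomeo, coe_smul_drilledPreimage, toSphere_smul]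
      rfl

/-- Closing up after time `T` in the quotient means that some `γ ∈ Γ` sends `w` to its image under
the flow at time `T`, so `γ` translates along the geodesic by `T`. -/
theorem exists_liftedAxis_of_isClosedGeodesicLift {Γ : Subgroup PO21} {l : Set (UnitTangent Γ)}
    (h : IsClosedGeodesicLift Γ l) :
    ∃ γ ∈ Γ, ∃ w ∈ liftedAxis γ,
      l = Set.range fun t : ℝ => toUnitTangent Γ (geodesicFlow t w) := by
  obtain ⟨w, ⟨T, hT, e⟩, rfl⟩ := h
  obtain ⟨γ, hγ, h⟩ := (toUnitTangent_eq_iff Γ _ _).1 e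
  exact ⟨γ, hγ, w, ⟨T, hT, h⟩, rfl⟩

end

end CRSpherical

theorem mainTheorem5 (Γ : Subgroup PO21) (hdiscrete : DiscreteTopology Γ)
    (hcocompact : CompactSpace (Surface Γ)) :
    (∀ γ ∈ Γ, IsLoxodromic (toPU γ) →
      CrownEmbedded (Γ.map toPU) (toPU γ) ∧
      Nonempty (QuotientOf (Γ.map toPU) (crownComplement (Γ.map toPU) (toPU γ)) ≃ₜ
        Drilled Γ (closedOrbit Γ γ))) ∧
    ((∀ g ∈ Γ, g ≠ 1 → ∀ x : HR2, g • x ≠ x) →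
      ∀ l : Set (UnitTangent Γ), IsClosedGeodesicLift Γ l →
        ∃ γ ∈ Γ, IsLoxodromic (toPU γ) ∧ closedOrbit Γ γ = l ∧
          ∀ m : Drilled Γ l, ∃ U : CRUniformization (Drilled Γ l) m,
            U.Ω = crownComplement (Γ.map toPU) (toPU γ) ∧ U.ρ.range = Γ.map toPU) := by
  constructor
  · intro γ _ _
    refine ⟨crownEmbedded Γ γ, ?_⟩
    rw [crownComplement_eq]
    exact ⟨drilledQuotientHomeo Γ _ _ rfl⟩
  · intro hfree l hl
    obtain ⟨γ, hγ, w, hw, rfl⟩ := exists_liftedAxis_of_isClosedGeodesicLift hl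
    have e := closedOrbit_eq_range (Γ := Γ) hw
    refine ⟨γ, hγ, isLoxodromic_of_mem_liftedAxis hw, e, ?_⟩
    rw [crownComplement_eq, e]
    exact exists_uniformization hfree (e ▸ isClosed_closedOrbit hγ hw)
      (isPathConnected_drilledPreimage Γ w)
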